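/- Let $\mathcal K$ be a separable complex Hilbert space with a real structure $\mathcal C$ (an anti-linear isometric involution); write $\overline v=\mathcal C v$ and $\overline A=\mathcal C A\,\mathcal C$. Let $(\mathcal K,J,S)$ be a Real Krein space of kind $(\eta,\tau)\in\{-1,1\}^2$, i.e. $J=J^*=\overline J$, $J^2=\mathbf 1$, $S=\overline S$ is unitary, $S^2=\eta\mathbf 1$ and $JS=\tau SJ$. Let $\mathbb{GU}(\mathcal K,J,S)$, with the norm topology, be the set of bounded operators $T$ on $\mathcal K$ with $T^*JT=J$ and $S^*\overline T S=T$ such that every point of $\sigma(T)\cap\mathbb S^1$ is isolated in $\sigma(T)$ and has a Riesz projection $P_\lambda(T)$ of finite rank. For $\lambda\in\mathbb S^1$ let $\nu_\pm(\lambda,T)$ be the number of positive/negative eigenvalues, counted with multiplicity, of the hermitian form $(v,w)\mapsto\langle v,Jw\rangle$ on $\mathcal E_\lambda(T)=\mathrm{Ran}\,P_\lambda(T)$, and let $\mathrm{Sig}(\lambda,T)=\nu_+(\lambda,T)-\nu_-(\lambda,T)$ and $\mathrm{Sig}(T)=\sum_{\lambda\in\mathbb S^1}\mathrm{Sig}(\lambda,T)$.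 Let $\mathcal E_{\mathbb S^1}(T)$ be the range of the Riesz projection $\sum_{\lambda\in\sigma(T)\cap\mathbb S^1}P_\lambda(T)$. **Theorem.** For every $T\in\mathbb{GU}(\mathcal K,J,S)$ the set $\sigma(T)\cap\mathbb S^1$ is finite and $\mathrm{Sig}(\lambda,T)=0$ for $\lambda\notin\sigma(T)\cap\mathbb S^1$, so that $\mathrm{Sig}(T)\in\mathbb Z$ is a finite sum. Moreover: 1. If $(\eta,\tau)=(1,1)$, then $\mathrm{Sec}(T)=\mathrm{Sig}(1,T)\bmod 2\in\mathbb Z_2$ is an invariant: $T\mapsto\mathrm{Sec}(T)$ is locally constant on $\mathbb{GU}(\mathcal K,J,S)$. 2. If $(\eta,\tau)=(-1,-1)$, then for every $T\in\mathbb{GU}(\mathcal K,J,S)$ one has $\mathrm{Sig}(T)=0$, and $\sum_{\lambda\in\sigma(T)\cap\mathbb S^1}\bigl(\nu_+(\lambda,T)+\nu_-(\lambda,T)\bigr)=\dim\mathcal E_{\mathbb S^1}(T)$ is finite and even; and $$\mathrm{Sig}_2(T)=\Bigl(\tfrac12\sum_{\lambda\in\sigma(T)\cap\mathbb S^1}\bigl(\nu_+(\lambda,T)+\nu_-(\lambda,T)\bigr)\Bigr)\bmod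 2=\bigl(\tfrac12\dim\mathcal E_{\mathbb S^1}(T)\bigr)\bmod 2\in\mathbb Z_2$$ is an invariant: $T\mapsto\mathrm{Sig}_2(T)$ is locally constant on $\mathbb{GU}(\mathcal K,J,S)$. 3. If $(\eta,\tau)=(-1,1)$, then $\mathrm{Sig}(T)\in2\mathbb Z$ for every $T\in\mathbb{GU}(\mathcal K,J,S)$. 4. If $(\eta,\tau)=(1,-1)$, then $\mathrm{Sig}(T)=0$ for every $T\in\mathbb{GU}(\mathcal K,J,S)$. -/

import Mathlib

namespace RealKrein

variable {K : Type*} [NormedAddCommGroup K] [InnerProductSpace ℂ K]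

section Spectral

/-- The closed disc of radius `r > 0` around `z` contains no point of the spectrum of `A`,
except possibly `z` itself. -/
def IsIsolatingRadius (A : K →L[ℂ] K) (z : ℂ) (r : ℝ) : Prop :=
  0 < r ∧ spectrum ℂ A ∩ Metric.closedBall z r ⊆ {z}

open Classical in
/-- The Riesz projection `P_z(A) = (2πi)⁻¹ ∮ (w - A)⁻¹ dw`, the integral being over a positively
oriented circle around `z` which, together with its interior, meets the spectrum at most at `z`.
It is set to `0` if there is no such circle. -/
noncomputable def rieszProj (A : K →L[ℂ] K) (z : ℂ) : K →L[ℂ] K :=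
  if h : ∃ r, IsIsolatingRadius A z r then
    (2 * (Real.pi : ℂ) * Complex.I)⁻¹ • circleIntegral (fun w => resolvent A w) z h.choose
  else 0

/-- The range `E_z(A)` of the Riesz projection. -/
noncomputable def rieszSpace (A : K →L[ℂ] K) (z : ℂ) : Submodule ℂ K :=
  LinearMap.range (rieszProj A z : K →ₗ[ℂ] K)

/-- Discrete eigenvalues: isolated points of the spectrum of finite (algebraic) multiplicity. -/
def IsDiscreteEigenvalue (A : K →L[ℂ] K) (z : ℂ) : Prop :=
  z ∈ spectrum ℂ A ∧ (∃ r, IsIsolatingRadius A z r) ∧ FiniteDimensional ℂ (rieszSpace A z)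

/-- The spectrum on the unit circle. -/
def circleSpectrum (A : K →L[ℂ] K) : Set ℂ := spectrum ℂ A ∩ Metric.sphere (0 : ℂ) 1

/-- The Riesz projection `P_{𝕊¹}(A)` when the spectrum of `A` on the unit circle consists of
finitely many isolated points: the contour is a union of small circles around these points. -/
noncomputable def rieszProjCircle (A : K →L[ℂ] K) : K →L[ℂ] K :=
  ∑ᶠ z ∈ circleSpectrum A, rieszProj A z

/-- The range `E_{𝕊¹}(A)`. -/
noncomputable def rieszSpaceCircle (A : K →L[ℂ] K) : Submodule ℂ K :=
  LinearMap.range (rieszProjCircle A : K →ₗ[ℂ] K)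

end Spectral

section Inertia

/-- The eigenspace for `μ` of the sesquilinear form `(w, v) ↦ ⟪w, J v⟫` restricted to `E`: the
vectors `v ∈ E` with `⟪w, J v⟫ = μ ⟪w, v⟫` for all `w ∈ E`. This is the `μ`-eigenspace of the
compression of `J` to `E`. -/
def formEigenspace (J : K →L[ℂ] K) (E : Submodule ℂ K) (μ : ℝ) : Submodule ℂ K where
  carrier := {v | v ∈ E ∧ ∀ w ∈ E, inner ℂ w (J v) = (μ : ℂ) * inner ℂ w v}
  add_mem' := by
    rintro a b ⟨ha, ha'⟩ ⟨hb, hb'⟩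
    refine ⟨E.add_mem ha hb, fun w hw => ?_⟩
    rw [map_add, inner_add_right, inner_add_right, ha' w hw, hb' w hw, mul_add]
  zero_mem' := ⟨E.zero_mem, fun w _ => by simp⟩
  smul_mem' := by
    rintro k a ⟨ha, ha'⟩
    refine ⟨E.smul_mem k ha, fun w hw => ?_⟩
    rw [map_smul, inner_smul_right, inner_smul_right, ha' w hw]
    ring

/-- The number of positive eigenvalues, with multiplicity, of the form `J` on `E`. -/
noncomputable def posIndex (J : K →L[ℂ] K) (E : Submodule ℂ K) : ℕ :=
  ∑ᶠ μ ∈ Set.Ioi (0 : ℝ), Module.finrank ℂ (formEigenspace J E μ)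

/-- The number of negative eigenvalues, with multiplicity, of the form `J` on `E`. -/
noncomputable def negIndex (J : K →L[ℂ] K) (E : Submodule ℂ K) : ℕ :=
  ∑ᶠ μ ∈ Set.Iio (0 : ℝ), Module.finrank ℂ (formEigenspace J E μ)

open Classical in
/-- The Krein inertia `ν₊(z, T)`, equal to `0` off the unit circle. -/
noncomputable def nuPos (J T : K →L[ℂ] K) (z : ℂ) : ℕ :=
  if z ∈ Metric.sphere (0 : ℂ) 1 then posIndex J (rieszSpace T z) else 0

open Classical in
/-- The Krein inertia `ν₋(z, T)`, equal to `0` off the unit circle. -/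
noncomputable def nuNeg (J T : K →L[ℂ] K) (z : ℂ) : ℕ :=
  if z ∈ Metric.sphere (0 : ℂ) 1 then negIndex J (rieszSpace T z) else 0

/-- The Krein signature `Sig(z, T) = ν₊(z, T) - ν₋(z, T)`. -/
noncomputable def kreinSig (J T : K →L[ℂ] K) (z : ℂ) : ℤ :=
  (nuPos J T z : ℤ) - (nuNeg J T z : ℤ)

/-- The global signature `Sig(T)`, the sum of `Sig(z, T)` over the unit circle. -/
noncomputable def globalSig (J T : K →L[ℂ] K) : ℤ :=
  ∑ᶠ z ∈ Metric.sphere (0 : ℂ) 1, kreinSig J T z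

/-- `Sec(T) = Sig(1, T) mod 2`. -/
noncomputable def sec (J T : K →L[ℂ] K) : ZMod 2 := (kreinSig J T 1 : ZMod 2)

/-- The sum of `ν₊(z, T) + ν₋(z, T)` over the spectrum on the unit circle. -/
noncomputable def totalInertia (J T : K →L[ℂ] K) : ℕ :=
  ∑ᶠ z ∈ circleSpectrum T, (nuPos J T z + nuNeg J T z)

/-- `Sig₂(T)`: one half of the total inertia, modulo `2`. The division is that of natural numbers,
so this is the intended quantity if the total inertia is even. -/
noncomputable def sig₂ (J T : K →L[ℂ] K) : ZMod 2 := ((totalInertia J T / 2 : ℕ) : ZMod 2)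

end Inertia

section Symmetry

/-- The operator `Ā = C A C`, for a real structure `C`. -/
noncomputable def conjOp (C : K ≃ₗᵢ⋆[ℂ] K) (A : K →L[ℂ] K) : K →L[ℂ] K :=
  (C.toContinuousLinearEquiv : K →SL[starRingEnd ℂ] K).comp
    (A.comp (C.toContinuousLinearEquiv : K →SL[starRingEnd ℂ] K))

variable [CompleteSpace K]

/-- `(K, J, S)` with the real structure `C` is a Real Krein space of kind `(η, τ) ∈ {1, -1}²`. -/
structure IsRealKreinSpace (C : K ≃ₗᵢ⋆[ℂ] K) (J S : K →L[ℂ] K) (η τ : ℤˣ) : Prop where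
  conj_conj : ∀ v, C (C v) = v
  J_adjoint : ContinuousLinearMap.adjoint J = J
  J_sq : J * J = 1
  J_real : conjOp C J = J
  S_unitary : S ∈ unitary (K →L[ℂ] K)
  S_real : conjOp C S = S
  S_sq : S * S = (η : ℤ) • (1 : K →L[ℂ] K)
  J_mul_S : J * S = (τ : ℤ) • (S * J)

/-- `T` is `J`-unitary: `T* J T = J`. -/
def IsJUnitary (J T : K →L[ℂ] K) : Prop := ContinuousLinearMap.adjoint T * J * T = J

/-- `T` is an essentially `𝕊¹`-gapped `J`-unitary: its spectrum on the unit circle is discrete. -/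
def IsGappedJUnitary (J T : K →L[ℂ] K) : Prop :=
  IsJUnitary J T ∧ ∀ z ∈ circleSpectrum T, IsDiscreteEigenvalue T z

/-- The set `𝔾𝕌(K, J, S)` of essentially `𝕊¹`-gapped `J`-unitaries with Real symmetry
`S* T̄ S = T`. -/
def gappedRealJUnitaries (C : K ≃ₗᵢ⋆[ℂ] K) (J S : K →L[ℂ] K) : Set (K →L[ℂ] K) :=
  {T | IsGappedJUnitary J T ∧ ContinuousLinearMap.adjoint S * conjOp C T * S = T}

end Symmetry

end RealKrein

open RealKrein

namespace RealKrein

open Metric Set Filter Topology MeasureTheory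
open scoped ComplexConjugate

/-! ### Contour integrals of the resolvent in a Banach algebra -/

section Contour

/-! The argument reduces every signature to dimensions of generalized eigenspaces and then uses two
symmetries of the spectrum. Since `J T* J` inverts `T`, the `J`-form pairs the generalized
eigenspaces at `l` and at `1 / conj l` (`IsKreinUnitary.eq_zero_of_orthogonal`). So their dimensions
agree, and on the unit circle the form is nondegenerate on each eigenspace: `ν₊ + ν₋` is the
dimension there, and `Sig` has the parity of that dimension.

The antiunitary `U = C S` commutes with `T`, squares to `η` and satisfies `J U = τ U J`. It carries
the generalized eigenspace at `l` to the one at `conj l`. If `η = -1`, it is a quaternionic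
structure on the spaces at real `l`, which therefore have even dimension
(`even_finrank_of_quaternionic`); pairing conjugate points makes the total dimension on the circle
even. If `τ = -1`, it reverses the sign of the form, so `Sig` is odd under conjugation and sums to
zero.

Local constancy rests on the stability of the rank of a Riesz projection over a fixed disc
(`IsFiniteDisc.eventually`): under perturbation an eigenvalue may split, but the dimensions in its
disc keep their sum. Near `1`, the eigenvalues other than `1` pair off under conjugation, or under
inversion when real, so the parity at `1` is unchanged. For `Sig₂`, reflection in the circle matches
what leaves outwards with what leaves inwards, and for `η = -1` the inner part is even; the
dimension on the circle thus changes by a multiple of `4`. -/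

theorem circleIntegral_comp_comm {E F : Type*} [NormedAddCommGroup E] [NormedSpace ℂ E]
    [CompleteSpace E] [NormedAddCommGroup F] [NormedSpace ℂ F] [CompleteSpace F]
    (L : E →L[ℂ] F) {f : ℂ → E} {c : ℂ} {R : ℝ} (hf : CircleIntegrable f c R) :
    (∮ w in C(c, R), L (f w)) = L (∮ w in C(c, R), f w) := by
  have := L.intervalIntegral_comp_comm hf.out
  simpa only [circleIntegral, map_smul] using this

theorem circleIntegral_swap {E : Type*} [NormedAddCommGroup E] [NormedSpace ℂ E]
    {f : ℂ → ℂ → E} {c : ℂ} {r R : ℝ} (hr : 0 ≤ r) (hR : 0 ≤ R)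
    (hf : ContinuousOn (Function.uncurry f) (sphere c R ×ˢ sphere c r)) :
    (∮ w in C(c, R), ∮ u in C(c, r), f w u) = ∮ u in C(c, r), ∮ w in C(c, R), f w u := by
  have hg : Continuous fun p : ℝ × ℝ => deriv (circleMap c R) p.1 • deriv (circleMap c r) p.2 •
      f (circleMap c R p.1) (circleMap c r p.2) := by
    simp only [deriv_circleMap]
    refine Continuous.smul (by fun_prop) (Continuous.smul (by fun_prop) ?_)
    exact hf.comp_continuous (f := fun p : ℝ × ℝ => (circleMap c R p.1, circleMap c r p.2))
      (by fun_prop) fun p => ⟨circleMap_mem_sphere c hR _, circleMap_mem_sphere c hr _⟩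
  simp only [circleIntegral, intervalIntegral.integral_of_le Real.two_pi_pos.le,
    ← MeasureTheory.integral_smul]
  rw [integral_integral_swap]
  · refine integral_congr_ae (.of_forall fun x => integral_congr_ae (.of_forall fun y => ?_))
    exact smul_comm _ _ _
  · rw [Measure.prod_restrict]
    exact (hg.continuousOn.integrableOn_compact (isCompact_Icc.prod isCompact_Icc)).mono_set
      (prod_mono Ioc_subset_Icc_self Ioc_subset_Icc_self)

variable {A : Type*} [NormedRing A] [NormedAlgebra ℂ A]

/-- The contour integral `(2πi)⁻¹ ∮ (w - a)⁻¹ dw` over the circle of radius `r` around `z`. -/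
noncomputable def contourProj (a : A) (z : ℂ) (r : ℝ) : A :=
  (2 * (Real.pi : ℂ) * Complex.I)⁻¹ • ∮ w in C(z, r), resolvent a w

theorem sub_mul_resolvent {a : A} {w : ℂ} (hw : w ∈ resolventSet ℂ a) :
    (algebraMap ℂ A w - a) * resolvent a w = 1 := Ring.mul_inverse_cancel _ hw

theorem resolvent_mul_sub {a : A} {w : ℂ} (hw : w ∈ resolventSet ℂ a) :
    resolvent a w * (algebraMap ℂ A w - a) = 1 := Ring.inverse_mul_cancel _ hw

theorem commute_resolvent {a b : A} (h : Commute b a) (w : ℂ) : Commute b (resolvent a w) := by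
  have h1 : Commute b (algebraMap ℂ A w - a) := Commute.sub_right (Algebra.commutes' w b).symm h
  by_cases hw : IsUnit (algebraMap ℂ A w - a)
  · obtain ⟨u, hu⟩ := hw
    rw [← hu] at h1
    rw [resolvent, ← hu, Ring.inverse_unit]
    exact h1.units_inv_right
  · rw [resolvent, Ring.inverse_non_unit _ hw]
    exact Commute.zero_right b

theorem resolvent_mul_resolvent {a : A} {w u : ℂ} (hw : w ∈ resolventSet ℂ a)
    (hu : u ∈ resolventSet ℂ a) (hne : w ≠ u) :
    resolvent a w * resolvent a u = (w - u)⁻¹ • (resolvent a u - resolvent a w) := by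
  have h1 : resolvent a u - resolvent a w = (w - u) • (resolvent a w * resolvent a u) := by
    calc resolvent a u - resolvent a w
        = resolvent a w * ((algebraMap ℂ A w - a) - (algebraMap ℂ A u - a)) * resolvent a u := by
          rw [mul_sub, sub_mul, resolvent_mul_sub hw, mul_assoc, sub_mul_resolvent hu, one_mul,
            mul_one]
      _ = _ := by
          rw [sub_sub_sub_cancel_right, Algebra.algebraMap_eq_smul_one,
            Algebra.algebraMap_eq_smul_one, ← sub_smul, mul_smul_comm, mul_one, smul_mul_assoc]
  rw [h1, smul_smul, inv_mul_cancel₀ (sub_ne_zero.2 hne), one_smul]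

variable [CompleteSpace A]

theorem continuousOn_resolvent (a : A) : ContinuousOn (resolvent a) (resolventSet ℂ a) :=
  fun _ hw => (spectrum.hasDerivAt_resolvent_const_left hw).continuousAt.continuousWithinAt

theorem commute_circleIntegral {b : A} {f : ℂ → A} {z : ℂ} {r : ℝ} (hf : CircleIntegrable f z r)
    (h : ∀ w, Commute b (f w)) : Commute b (∮ w in C(z, r), f w) := by
  have h1 := circleIntegral_comp_comm (ContinuousLinearMap.mul ℂ A b) hf
  have h2 := circleIntegral_comp_comm ((ContinuousLinearMap.mul ℂ A).flip b) hf
  simp only [ContinuousLinearMap.flip_apply, ContinuousLinearMap.mul_apply'] at h1 h2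
  exact h1.symm.trans ((congrArg (fun g => ∮ w in C(z, r), g w) (funext fun w => h w)).trans h2)

theorem circleIntegrable_resolvent {a : A} {z : ℂ} {r : ℝ} (hr : 0 ≤ r)
    (h : sphere z r ⊆ resolventSet ℂ a) : CircleIntegrable (resolvent a) z r :=
  ((continuousOn_resolvent a).mono h).circleIntegrable hr

theorem commute_contourProj {a b : A} {z : ℂ} {r : ℝ} (hr : 0 ≤ r)
    (h : sphere z r ⊆ resolventSet ℂ a) (hb : Commute b a) : Commute b (contourProj a z r) :=
  (commute_circleIntegral (circleIntegrable_resolvent hr h) (commute_resolvent hb)).smul_right _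

theorem contourProj_eq_of_annulus {a : A} {z : ℂ} {r R : ℝ} (hr : 0 < r) (hrR : r ≤ R)
    (h : closedBall z R \ ball z r ⊆ resolventSet ℂ a) :
    contourProj a z R = contourProj a z r := by
  unfold contourProj
  rw [Complex.circleIntegral_eq_of_differentiable_on_annulus_off_countable hr hrR countable_empty
    ((continuousOn_resolvent a).mono h)]
  intro w hw
  exact (spectrum.hasDerivAt_resolvent_const_left (h ⟨ball_subset_closedBall hw.1.1,
    fun h' => hw.1.2 (ball_subset_closedBall h')⟩)).differentiableAt

theorem contourProj_eq_zero {a : A} {z : ℂ} {r : ℝ} (hr : 0 ≤ r)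
    (h : closedBall z r ⊆ resolventSet ℂ a) : contourProj a z r = 0 := by
  unfold contourProj
  rw [Complex.circleIntegral_eq_zero_of_differentiable_on_off_countable hr countable_empty
    ((continuousOn_resolvent a).mono h)
    fun w hw => (spectrum.hasDerivAt_resolvent_const_left (h (ball_subset_closedBall hw.1))).differentiableAt,
    smul_zero]

/-- The witness is the Cauchy-type integral `(2πi)⁻¹ ∮ (w - l)⁻¹ (w - a)⁻¹ dw`. It inverts `l - a`
on the complement of the Riesz projection, even when `l` is in the spectrum. -/
theorem exists_mul_eq_one_sub_contourProj {a : A} {z l : ℂ} {r : ℝ} (hr : 0 ≤ r)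
    (h : sphere z r ⊆ resolventSet ℂ a) (hl : l ∈ ball z r) :
    ∃ q : A, Commute q a ∧ (algebraMap ℂ A l - a) * q = 1 - contourProj a z r := by
  have hne : ∀ w ∈ sphere z r, w - l ≠ 0 := fun w hw h0 => by
    rw [sub_eq_zero] at h0
    subst h0
    exact absurd hl (by simp [mem_sphere.1 hw])
  have hc : ContinuousOn (fun w => (w - l)⁻¹ • resolvent a w) (sphere z r) :=
    ContinuousOn.smul (ContinuousOn.inv₀ (by fun_prop) hne) ((continuousOn_resolvent a).mono h)
  have hpi : (2 * (Real.pi : ℂ) * Complex.I) ≠ 0 := Complex.two_pi_I_ne_zero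
  refine ⟨(2 * (Real.pi : ℂ) * Complex.I)⁻¹ • ∮ w in C(z, r), (w - l)⁻¹ • resolvent a w,
    ?_, ?_⟩
  · exact ((commute_circleIntegral (hc.circleIntegrable hr) fun w =>
      (commute_resolvent (Commute.refl a) w).smul_right _).smul_right _).symm
  · have h1 := circleIntegral_comp_comm (ContinuousLinearMap.mul ℂ A (algebraMap ℂ A l - a))
      (hc.circleIntegrable hr)
    simp only [ContinuousLinearMap.mul_apply'] at h1
    rw [mul_smul_comm, ← h1, circleIntegral.integral_congr hr
      (g := fun w => (w - l)⁻¹ • (1 : A) - resolvent a w), circleIntegral.integral_sub,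
      circleIntegral.integral_smul_const, circleIntegral.integral_sub_inv_of_mem_ball hl,
      smul_sub, contourProj, smul_smul, inv_mul_cancel₀ hpi, one_smul]
    · exact (ContinuousOn.smul (ContinuousOn.inv₀ (by fun_prop) hne)
        continuousOn_const).circleIntegrable hr
    · exact circleIntegrable_resolvent hr h
    · intro w hw
      have h2 : algebraMap ℂ A l - a = (algebraMap ℂ A w - a) - (w - l) • (1 : A) := by
        rw [Algebra.algebraMap_eq_smul_one, Algebra.algebraMap_eq_smul_one, sub_smul]; abel
      simp only
      rw [mul_smul_comm, h2, sub_mul, sub_mul_resolvent (h hw), smul_mul_assoc, one_mul, smul_sub,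
        smul_smul, inv_mul_cancel₀ (hne w hw), one_smul]

/-- One factor is moved to the larger circle and the resolvent identity is applied to the double
integral. As `w` lies outside the small circle, `∮ (w - u)⁻¹ du` vanishes there, while integrating
over `w` first gives `2πi` for each `u` inside. -/
theorem contourProj_mul_self {a : A} {z : ℂ} {r R : ℝ} (hr : 0 < r) (hrR : r < R)
    (h : closedBall z R \ ball z r ⊆ resolventSet ℂ a) :
    contourProj a z r * contourProj a z r = contourProj a z r := by
  have hR : 0 < R := hr.trans hrR
  have hsr : sphere z r ⊆ resolventSet ℂ a := fun w hw => h
    ⟨closedBall_subset_closedBall hrR.le (sphere_subset_closedBall hw), by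
      simp [mem_sphere.1 hw]⟩
  have hsR : sphere z R ⊆ resolventSet ℂ a := fun w hw => h
    ⟨sphere_subset_closedBall hw, by simp [mem_sphere.1 hw, hrR.le]⟩
  have hne : ∀ w ∈ sphere z R, ∀ u ∈ sphere z r, w ≠ u := fun w hw u hu h0 => by
    subst h0
    rw [mem_sphere] at hw hu
    linarith
  have hpi : (2 * (Real.pi : ℂ) * Complex.I) ≠ 0 := Complex.two_pi_I_ne_zero
  have hIr := circleIntegrable_resolvent hr.le hsr
  have hIR := circleIntegrable_resolvent hR.le hsR
  have hcr := (continuousOn_resolvent a).mono hsr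
  have hcR := (continuousOn_resolvent a).mono hsR
  have key : (∮ w in C(z, R), resolvent a w) * (∮ u in C(z, r), resolvent a u) =
      (2 * (Real.pi : ℂ) * Complex.I) • ∮ u in C(z, r), resolvent a u := by
    have h1 := circleIntegral_comp_comm
      ((ContinuousLinearMap.mul ℂ A).flip (∮ u in C(z, r), resolvent a u)) hIR
    simp only [ContinuousLinearMap.flip_apply, ContinuousLinearMap.mul_apply'] at h1
    have h2 : ∀ w ∈ sphere z R, resolvent a w * (∮ u in C(z, r), resolvent a u) =
        ∮ u in C(z, r), (w - u)⁻¹ • resolvent a u := by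
      intro w hw
      have h3 := circleIntegral_comp_comm (ContinuousLinearMap.mul ℂ A (resolvent a w)) hIr
      simp only [ContinuousLinearMap.mul_apply'] at h3
      have hci : ContinuousOn (fun u => (w - u)⁻¹) (closedBall z r) :=
        ContinuousOn.inv₀ (by fun_prop) fun u hu h0 => by
          rw [sub_eq_zero] at h0
          subst h0
          rw [mem_sphere] at hw
          rw [mem_closedBall] at hu
          linarith
      have hci' := hci.mono sphere_subset_closedBall
      rw [← h3, circleIntegral.integral_congr hr.le
        (g := fun u => (w - u)⁻¹ • resolvent a u - (w - u)⁻¹ • resolvent a w),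
        circleIntegral.integral_sub, circleIntegral.integral_smul_const,
        Complex.circleIntegral_eq_zero_of_differentiable_on_off_countable hr.le countable_empty hci,
        zero_smul, sub_zero]
      · intro u hu
        refine DifferentiableAt.inv (by fun_prop) fun h0 => ?_
        rw [sub_eq_zero] at h0
        subst h0
        rw [mem_sphere] at hw
        have := mem_ball.1 hu.1
        linarith
      · exact (hci'.smul hcr).circleIntegrable hr.le
      · exact (hci'.smul continuousOn_const).circleIntegrable hr.le
      · intro u hu
        simp only
        rw [resolvent_mul_resolvent (hsR hw) (hsr hu) (hne w hw u hu), smul_sub]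
    rw [← h1, circleIntegral.integral_congr hR.le h2, circleIntegral_swap hr.le hR.le]
    · rw [← circleIntegral.integral_smul]
      refine circleIntegral.integral_congr hr.le fun u hu => ?_
      rw [circleIntegral.integral_smul_const, circleIntegral.integral_sub_inv_of_mem_ball]
      rw [mem_ball, mem_sphere.1 hu]
      exact hrR
    · refine ContinuousOn.smul (f := fun p : ℂ × ℂ => (p.1 - p.2)⁻¹)
        (g := fun p : ℂ × ℂ => resolvent a p.2)
        (ContinuousOn.inv₀ (by fun_prop) fun p hp => sub_ne_zero.2 (hne _ hp.1 _ hp.2)) ?_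
      exact hcr.comp continuousOn_snd fun p hp => hp.2
  nth_rewrite 1 [← contourProj_eq_of_annulus hr hrR.le h]
  unfold contourProj
  rw [smul_mul_smul_comm, key, smul_smul, mul_assoc, inv_mul_cancel₀ hpi, mul_one]

/-- The map `(b, w) ↦ (w - b)⁻¹` is jointly continuous; compactness of `s` makes the estimate
uniform in `w`. -/
theorem eventually_resolvent_near {a : A} {s : Set ℂ} (hs : IsCompact s)
    (h : s ⊆ resolventSet ℂ a) {ε : ℝ} (hε : 0 < ε) :
    ∀ᶠ b in 𝓝 a, ∀ w ∈ s, w ∈ resolventSet ℂ b ∧ ‖resolvent b w - resolvent a w‖ < ε := by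
  refine hs.eventually_forall_of_forall_eventually fun w hw => ?_
  have hsub : Continuous fun p : A × ℂ => algebraMap ℂ A p.2 - p.1 :=
    ((continuous_algebraMap ℂ A).comp continuous_snd).sub continuous_fst
  have h1 : ∀ᶠ p : A × ℂ in 𝓝 (a, w), p.2 ∈ resolventSet ℂ p.1 :=
    hsub.continuousAt.preimage_mem_nhds (Units.isOpen.mem_nhds (show IsUnit _ from h hw))
  have h2 : ContinuousAt (fun p : A × ℂ => resolvent p.1 p.2) (a, w) :=
    ContinuousAt.comp (f := fun p : A × ℂ => algebraMap ℂ A p.2 - p.1) (g := Ring.inverse)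
      (NormedRing.inverse_continuousAt (h hw).unit) hsub.continuousAt
  have h3 : ContinuousAt (fun p : A × ℂ => resolvent a p.2) (a, w) :=
    ContinuousAt.comp (f := Prod.snd) (g := resolvent a)
      (spectrum.hasDerivAt_resolvent_const_left (h hw)).continuousAt continuousAt_snd
  have h4 := (h2.sub h3).norm.tendsto.eventually_lt_const (u := ε) (by simpa using hε)
  exact h1.and h4

theorem eventually_contourProj_near {a : A} {z : ℂ} {r : ℝ} (hr : 0 < r)
    (h : sphere z r ⊆ resolventSet ℂ a) {ε : ℝ} (hε : 0 < ε) :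
    ∀ᶠ b in 𝓝 a, ‖contourProj b z r - contourProj a z r‖ < ε := by
  have hε' : 0 < ε / (2 * r) := by positivity
  filter_upwards [eventually_resolvent_near (isCompact_sphere z r) h hε'] with b hb
  have h1 := circleIntegral.norm_two_pi_i_inv_smul_integral_le_of_norm_le_const hr.le
    (f := fun w => resolvent b w - resolvent a w) (c := z) (C := ε / (2 * r))
    fun w hw => (hb w hw).2.le
  rw [circleIntegral.integral_sub (circleIntegrable_resolvent hr.le fun w hw => (hb w hw).1)
    (circleIntegrable_resolvent hr.le h), smul_sub] at h1
  refine lt_of_le_of_lt h1 ?_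
  have : r * (ε / (2 * r)) = ε / 2 := by field_simp
  linarith

end Contour

/-! ### Dimensions of independent families of subspaces -/

section Dimension

variable {K : Type*} [AddCommGroup K] [Module ℂ K]

theorem finrank_biSup_eq_sum {ι : Type*} {V : ι → Submodule ℂ K} (hV : iSupIndep V)
    (s : Finset ι) (hfin : ∀ i ∈ s, FiniteDimensional ℂ (V i)) :
    FiniteDimensional ℂ (⨆ i ∈ s, V i : Submodule ℂ K) ∧
      Module.finrank ℂ (⨆ i ∈ s, V i : Submodule ℂ K) = ∑ i ∈ s, Module.finrank ℂ (V i) := by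
  classical
  induction s using Finset.induction_on with
  | empty =>
    rw [show (⨆ i ∈ (∅ : Finset ι), V i) = ⊥ by simp]
    exact ⟨inferInstance, by simp⟩
  | insert a s ha ih =>
    obtain ⟨h1, h2⟩ := ih fun i hi => hfin i (Finset.mem_insert_of_mem hi)
    have h3 := hfin a (Finset.mem_insert_self a s)
    rw [Finset.iSup_insert, Finset.sum_insert ha]
    refine ⟨inferInstance, ?_⟩
    have hd : Disjoint (V a) (⨆ i ∈ s, V i) := (hV a).mono_right <|
      iSup₂_le fun i hi => le_iSup₂_of_le i (ne_of_mem_of_not_mem hi ha) le_rfl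
    have h4 := Submodule.finrank_sup_add_finrank_inf_eq (V a) (⨆ i ∈ s, V i)
    rw [hd.eq_bot, finrank_bot, add_zero, h2] at h4
    exact h4

theorem finrank_iSup_eq_finsum {ι : Type*} {V : ι → Submodule ℂ K} (hV : iSupIndep V)
    (hfin : FiniteDimensional ℂ (⨆ i, V i : Submodule ℂ K)) :
    {i | V i ≠ ⊥}.Finite ∧
      Module.finrank ℂ (⨆ i, V i : Submodule ℂ K) = ∑ᶠ i, Module.finrank ℂ (V i) := by
  classical
  have hV' : ∀ i, FiniteDimensional ℂ (V i) := fun i =>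
    Submodule.finiteDimensional_of_le (le_iSup V i)
  -- Each nonzero member contributes at least one dimension, so one more of them than the total
  -- dimension is impossible.
  have hf : {i | V i ≠ ⊥}.Finite := by
    by_contra hinf
    obtain ⟨s, hs, hcard⟩ := Set.Infinite.exists_subset_card_eq hinf
      (Module.finrank ℂ (⨆ i, V i : Submodule ℂ K) + 1)
    have h1 := (finrank_biSup_eq_sum hV s fun i _ => hV' i).2
    have h2 : Module.finrank ℂ (⨆ i ∈ s, V i : Submodule ℂ K) ≤
        Module.finrank ℂ (⨆ i, V i : Submodule ℂ K) :=
      Submodule.finrank_mono (iSup₂_le fun i _ => le_iSup V i)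
    have h3 : s.card ≤ ∑ i ∈ s, Module.finrank ℂ (V i) := by
      rw [Finset.card_eq_sum_ones]
      exact Finset.sum_le_sum fun i hi =>
        Nat.one_le_iff_ne_zero.2 fun h0 => hs hi (Submodule.finrank_eq_zero.1 h0)
    omega
  refine ⟨hf, ?_⟩
  have h1 : (⨆ i, V i) = ⨆ i ∈ hf.toFinset, V i := by
    refine le_antisymm (iSup_le fun i => ?_) (iSup₂_le fun i _ => le_iSup V i)
    by_cases hi : V i = ⊥
    · rw [hi]
      exact bot_le
    · exact le_iSup₂_of_le i (by simpa using hi) le_rfl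
  rw [h1, (finrank_biSup_eq_sum hV _ fun i _ => hV' i).2]
  refine (finsum_eq_sum_of_support_subset _ fun i hi => ?_).symm
  simp only [Function.mem_support] at hi
  simp only [Finite.coe_toFinset, mem_ofPred_eq]
  rintro h0
  rw [h0, finrank_bot] at hi
  exact hi rfl

end Dimension

/-! ### Generalized eigenspaces and Riesz projections over discs -/

section Gen

variable {K : Type*} [NormedAddCommGroup K] [InnerProductSpace ℂ K]

/-- The generalized eigenspace `⋃ₙ ker (T - l)ⁿ`. -/
noncomputable def genSpace (T : K →L[ℂ] K) (l : ℂ) : Submodule ℂ K :=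
  Module.End.maxGenEigenspace (T : K →ₗ[ℂ] K) l

theorem mem_genSpace {T : K →L[ℂ] K} {l : ℂ} {v : K} :
    v ∈ genSpace T l ↔ ∃ k : ℕ, ((T - l • (1 : K →L[ℂ] K)) ^ k) v = 0 := by
  rw [genSpace, Module.End.mem_maxGenEigenspace]
  refine exists_congr fun k => ?_
  have : (((T - l • (1 : K →L[ℂ] K)) ^ k : K →L[ℂ] K) : K →ₗ[ℂ] K) =
      ((T : K →ₗ[ℂ] K) - l • (1 : Module.End ℂ K)) ^ k := by
    rw [ContinuousLinearMap.toLinearMap_pow]; rfl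
  rw [← this]; rfl

theorem pow_apply_eq_zero_of_le {A : K →L[ℂ] K} {v : K} {m n : ℕ} (hmn : m ≤ n)
    (h : (A ^ m) v = 0) : (A ^ n) v = 0 := by
  rw [← Nat.sub_add_cancel hmn, pow_add, mul_apply_eq_comp, h, map_zero]

theorem iSupIndep_genSpace (T : K →L[ℂ] K) : iSupIndep (genSpace T) :=
  Module.End.independent_maxGenEigenspace _

theorem sub_smul_one_eq_neg (T : K →L[ℂ] K) (l : ℂ) :
    T - l • (1 : K →L[ℂ] K) = -(algebraMap ℂ (K →L[ℂ] K) l - T) := by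
  rw [Algebra.algebraMap_eq_smul_one, neg_sub]

theorem isUnit_sub_smul_one {T : K →L[ℂ] K} {l : ℂ} :
    IsUnit (T - l • (1 : K →L[ℂ] K)) ↔ l ∈ resolventSet ℂ T := by
  rw [sub_smul_one_eq_neg, IsUnit.neg_iff]; rfl

theorem genSpace_eq_bot {T : K →L[ℂ] K} {l : ℂ} (hl : l ∈ resolventSet ℂ T) :
    genSpace T l = ⊥ := by
  rw [eq_bot_iff]
  intro v hv
  obtain ⟨k, hk⟩ := mem_genSpace.1 hv
  obtain ⟨u, hu⟩ := (isUnit_sub_smul_one.2 hl).pow k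
  rw [← hu] at hk
  have : (↑u⁻¹ * (u : K →L[ℂ] K)) v = 0 := by rw [mul_apply_eq_comp, hk, map_zero]
  simpa using this

/-- `P` is injective on the range of `Q`: a vector there killed by `P` satisfies `‖x‖ = ‖(P - Q)
x‖`, which forces `x = 0`. -/
theorem finrank_range_le_of_norm_sub_lt_one {P Q : K →L[ℂ] K} (hQ : Q * Q = Q)
    (h : ‖P - Q‖ < 1) [FiniteDimensional ℂ (LinearMap.range (P : K →ₗ[ℂ] K))] :
    FiniteDimensional ℂ (LinearMap.range (Q : K →ₗ[ℂ] K)) ∧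
      Module.finrank ℂ (LinearMap.range (Q : K →ₗ[ℂ] K)) ≤
        Module.finrank ℂ (LinearMap.range (P : K →ₗ[ℂ] K)) := by
  set f : LinearMap.range (Q : K →ₗ[ℂ] K) →ₗ[ℂ] LinearMap.range (P : K →ₗ[ℂ] K) :=
    (P : K →ₗ[ℂ] K).rangeRestrict ∘ₗ (LinearMap.range (Q : K →ₗ[ℂ] K)).subtype with hf
  have hinj : Function.Injective f := by
    rw [injective_iff_map_eq_zero]
    rintro ⟨_, x, rfl⟩ hx
    have h0 : P (Q x) = 0 := congrArg Subtype.val hx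
    have h1 : Q (Q x) = Q x := congrArg (fun B : K →L[ℂ] K => B x) hQ
    have h2 : ‖Q x‖ ≤ ‖P - Q‖ * ‖Q x‖ := by
      have := (P - Q).le_opNorm (Q x)
      rwa [sub_apply, h0, h1, zero_sub, norm_neg] at this
    have h3 : Q x = 0 := by
      by_contra hne
      have := norm_pos_iff.2 hne
      nlinarith
    exact Subtype.ext h3
  exact ⟨FiniteDimensional.of_injective f hinj, LinearMap.finrank_le_finrank_of_injective hinj⟩

variable [CompleteSpace K]

theorem circleIntegral_apply {f : ℂ → K →L[ℂ] K} {z : ℂ} {r : ℝ} (hf : CircleIntegrable f z r)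
    (v : K) : (∮ w in C(z, r), f w) v = ∮ w in C(z, r), f w v :=
  (circleIntegral_comp_comm (ContinuousLinearMap.apply ℂ K v) hf).symm

/-- With `A = T - l`, one has `(w - l) R(w) v = v + R(w) A v`. Each use of this lowers the
nilpotency order of the vector and raises the order of the pole at `l`, which is why `k` is general
in the induction. -/
theorem circleIntegral_resolvent_apply {T : K →L[ℂ] K} {z l : ℂ} {r : ℝ} (hr : 0 ≤ r)
    (h : sphere z r ⊆ resolventSet ℂ T) (hl : l ∉ sphere z r) (n : ℕ) :
    ∀ (v : K) (k : ℕ), ((T - l • (1 : K →L[ℂ] K)) ^ n) v = 0 →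
      (∮ w in C(z, r), (w - l) ^ (-(k : ℤ)) • resolvent T w v) =
        (∮ w in C(z, r), (w - l) ^ (-(k : ℤ) - 1)) • v := by
  have hne : ∀ w ∈ sphere z r, w - l ≠ 0 := fun w hw h0 => hl (sub_eq_zero.1 h0 ▸ hw)
  have hpow : ∀ m : ℤ, ContinuousOn (fun w : ℂ => (w - l) ^ m) (sphere z r) := fun m =>
    ContinuousOn.zpow₀ (by fun_prop) m fun w hw => Or.inl (hne w hw)
  induction n with
  | zero =>
    intro v k hv
    rw [pow_zero, one_apply_eq_self] at hv
    simp [hv, circleIntegral]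
  | succ n ih =>
    intro v k hv
    set A := T - l • (1 : K →L[ℂ] K) with hA
    have h1 := ih (A v) (k + 1) (by rwa [pow_succ, mul_apply_eq_comp] at hv)
    -- The exponent is at most `-2`, so the remainder has no residue.
    rw [circleIntegral.integral_sub_zpow_of_ne (by push_cast; omega), zero_smul] at h1
    rw [circleIntegral.integral_congr hr (g := fun w => (w - l) ^ (-(k : ℤ) - 1) • v +
      (w - l) ^ (-((k + 1 : ℕ) : ℤ)) • resolvent T w (A v)), circleIntegral.integral_add, h1,
      add_zero, circleIntegral.integral_smul_const]
    · exact ((hpow _).smul continuousOn_const).circleIntegrable hr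
    · refine ((hpow _).smul ?_).circleIntegrable hr
      exact ((continuousOn_resolvent T).mono h).clm_apply continuousOn_const
    · intro w hw
      have h2 : resolvent T w (w • v - T v) = v := by
        have := congrArg (fun B : K →L[ℂ] K => B v) (resolvent_mul_sub (h hw))
        simpa [Algebra.algebraMap_eq_smul_one] using this
      have h3 : (w - l) • resolvent T w v = v + resolvent T w (A v) := by
        nth_rewrite 2 [← h2]
        rw [← map_smul, ← map_add, hA]
        congr 1
        simp only [sub_apply, FunLike.coe_smul, Pi.smul_apply, sub_smul,
          one_apply_eq_self]
        abel
      beta_reduce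
      have h4 : -((k + 1 : ℕ) : ℤ) = -(k : ℤ) - 1 := by push_cast; ring
      rw [h4, ← smul_add, ← h3, smul_smul, zpow_sub_one₀ (hne w hw), mul_assoc,
        inv_mul_cancel₀ (hne w hw), mul_one]

theorem contourProj_apply_of_mem {T : K →L[ℂ] K} {z l : ℂ} {r : ℝ} (hr : 0 ≤ r)
    (h : sphere z r ⊆ resolventSet ℂ T) (hl : l ∈ ball z r) {v : K} (hv : v ∈ genSpace T l) :
    contourProj T z r v = v := by
  obtain ⟨n, hn⟩ := mem_genSpace.1 hv
  have h1 := circleIntegral_resolvent_apply hr h (l := l)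
    (fun h' => by rw [mem_ball, mem_sphere.1 h'] at hl; exact lt_irrefl _ hl) n v 0 hn
  simp only [Nat.cast_zero, neg_zero, zpow_zero, one_smul, zero_sub, zpow_neg_one] at h1
  rw [circleIntegral.integral_sub_inv_of_mem_ball hl] at h1
  rw [contourProj, smul_apply, circleIntegral_apply (circleIntegrable_resolvent hr h), h1,
    smul_smul, inv_mul_cancel₀ Complex.two_pi_I_ne_zero, one_smul]

theorem contourProj_apply_of_notMem {T : K →L[ℂ] K} {z l : ℂ} {r : ℝ} (hr : 0 ≤ r)
    (h : sphere z r ⊆ resolventSet ℂ T) (hl : l ∉ ball z r) {v : K} (hv : v ∈ genSpace T l) :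
    contourProj T z r v = 0 := by
  by_cases hl' : l ∈ sphere z r
  · rw [genSpace_eq_bot (h hl'), Submodule.mem_bot] at hv
    rw [hv, map_zero]
  obtain ⟨n, hn⟩ := mem_genSpace.1 hv
  have h1 := circleIntegral_resolvent_apply hr h hl' n v 0 hn
  simp only [Nat.cast_zero, neg_zero, zpow_zero, one_smul, zero_sub, zpow_neg_one] at h1
  have hne : ∀ w ∈ closedBall z r, w - l ≠ 0 := fun w hw h0 => by
    rw [sub_eq_zero] at h0
    subst h0
    rcases (mem_closedBall.1 hw).lt_or_eq with h' | h'
    · exact hl h'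
    · exact hl' h'
  rw [Complex.circleIntegral_eq_zero_of_differentiable_on_off_countable
    (f := fun w => (w - l)⁻¹) hr countable_empty
    (ContinuousOn.inv₀ (by fun_prop) hne) fun w hw => DifferentiableAt.inv (by fun_prop)
      (hne w (ball_subset_closedBall hw.1)), zero_smul] at h1
  rw [contourProj, smul_apply, circleIntegral_apply (circleIntegrable_resolvent hr h), h1,
    smul_zero]

/-- The range of the contour integral `contourProj T z r`. -/
noncomputable def contourSpace (T : K →L[ℂ] K) (z : ℂ) (r : ℝ) : Submodule ℂ K :=
  LinearMap.range ((contourProj T z r : K →L[ℂ] K) : K →ₗ[ℂ] K)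

/-- The annulus between the circles of radius `r` and `R` around `z` avoids the spectrum, and the
Riesz projection of the disc has finite rank. -/
structure IsFiniteDisc (T : K →L[ℂ] K) (z : ℂ) (r R : ℝ) : Prop where
  pos : 0 < r
  lt : r < R
  annulus : closedBall z R \ ball z r ⊆ resolventSet ℂ T
  finite : FiniteDimensional ℂ (contourSpace T z r)

theorem sphere_subset_annulus (z : ℂ) {r R : ℝ} (h : r ≤ R) :
    sphere z r ⊆ closedBall z R \ ball z r := fun w hw =>
  ⟨closedBall_subset_closedBall h (sphere_subset_closedBall hw), by simp [mem_sphere.1 hw]⟩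

namespace IsFiniteDisc

variable {T : K →L[ℂ] K} {z : ℂ} {r R : ℝ} (hD : IsFiniteDisc T z r R)
include hD

theorem sphere_subset : sphere z r ⊆ resolventSet ℂ T :=
  (sphere_subset_annulus z hD.lt.le).trans hD.annulus

theorem apply_apply (v : K) : contourProj T z r (contourProj T z r v) = contourProj T z r v :=
  congrArg (fun B : K →L[ℂ] K => B v) (contourProj_mul_self hD.pos hD.lt hD.annulus)

theorem genSpace_le {l : ℂ} (hl : l ∈ ball z r) :
    genSpace T l ≤ contourSpace T z r := fun v hv =>
  ⟨v, contourProj_apply_of_mem hD.pos.le hD.sphere_subset hl hv⟩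

theorem apply_mem_range {A : K →L[ℂ] K} (hA : Commute A T) :
    ∀ v ∈ contourSpace T z r,
      (A : K →ₗ[ℂ] K) v ∈ contourSpace T z r := by
  rintro _ ⟨v, rfl⟩
  refine ⟨A v, ?_⟩
  have := commute_contourProj hD.pos.le hD.sphere_subset hA
  exact (congrArg (fun B : K →L[ℂ] K => B v) this.eq).symm

/-- On its finite-dimensional range the restriction of `T` decomposes into generalized eigenspaces.
Those for `l` outside the disc are killed by the projection and also fixed by it, hence vanish. -/
theorem range_eq_iSup : contourSpace T z r =
    ⨆ l : ball z r, genSpace T l := by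
  have := hD.finite
  set F := contourSpace T z r with hF
  refine le_antisymm ?_ (iSup_le fun l => hD.genSpace_le l.2)
  have h1 := Module.End.iSup_maxGenEigenspace_eq_top
    (LinearMap.restrict (T : K →ₗ[ℂ] K) (hD.apply_mem_range (Commute.refl T)))
  have h2 := congrArg (Submodule.map F.subtype) h1
  rw [Submodule.map_iSup, Submodule.map_top, Submodule.range_subtype] at h2
  rw [← h2]
  refine iSup_le fun l => ?_
  rintro _ ⟨⟨v, hv⟩, hv', rfl⟩
  have h3 : v ∈ genSpace T l := by
    rw [SetLike.mem_coe, Module.End.maxGenEigenspace,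
      Module.End.genEigenspace_restrict] at hv'
    exact hv'
  by_cases hl : l ∈ ball z r
  · exact le_iSup (fun l : ball z r => genSpace T l) ⟨l, hl⟩ h3
  · have h4 := contourProj_apply_of_notMem hD.pos.le hD.sphere_subset hl h3
    obtain ⟨x, rfl⟩ := hv
    have h5 : contourProj T z r x = 0 := (hD.apply_apply x).symm.trans h4
    change contourProj T z r x ∈ _
    rw [h5]
    exact Submodule.zero_mem _

theorem finiteDimensional_genSpace {l : ℂ} (hl : l ∈ ball z r) :
    FiniteDimensional ℂ (genSpace T l) := by
  have := hD.finite
  exact Submodule.finiteDimensional_of_le (hD.genSpace_le hl)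

theorem finite_support : {l ∈ ball z r | genSpace T l ≠ ⊥}.Finite := by
  have h1 := hD.finite
  rw [hD.range_eq_iSup] at h1
  have h2 := (finrank_iSup_eq_finsum ((iSupIndep_genSpace T).comp Subtype.val_injective) h1).1
  refine (h2.image Subtype.val).subset ?_
  rintro l ⟨hl, hl'⟩
  exact ⟨⟨l, hl⟩, hl', rfl⟩

theorem finrank_range : Module.finrank ℂ (contourSpace T z r) =
    ∑ᶠ l ∈ ball z r, Module.finrank ℂ (genSpace T l) := by
  have h1 := hD.finite
  rw [hD.range_eq_iSup] at h1 ⊢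
  refine (finrank_iSup_eq_finsum ((iSupIndep_genSpace T).comp
    Subtype.val_injective) h1).2.trans ?_
  exact finsum_set_coe_eq_finsum_mem (f := fun l => Module.finrank ℂ (genSpace T l)) (ball z r)

/-- A Fitting decomposition of the whole space: on the range of the projection it is the
finite-dimensional one, and on the complement `T - l` is invertible. All large `n` are allowed so
that `n` can later exceed a given nilpotency order. -/
theorem eventually_decomposition {l : ℂ} (hl : l ∈ ball z r) :
    ∀ᶠ n in atTop, ∀ x : K, ∃ u ∈ genSpace T l, ∃ y,
      x = u + ((T - l • (1 : K →L[ℂ] K)) ^ n) y := by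
  have := hD.finite
  set A := T - l • (1 : K →L[ℂ] K) with hA
  have hAT : Commute A T := (Commute.refl T).sub_left ((Commute.one_left T).smul_left l)
  obtain ⟨q, hq, hq'⟩ := exists_mul_eq_one_sub_contourProj hD.pos.le hD.sphere_subset hl
  have hqA : A * (-q) = 1 - contourProj T z r := by
    rw [← hq', hA, sub_smul_one_eq_neg, neg_mul_neg]
  have hcq : Commute A (-q) :=
    (hq.neg_left.sub_right ((Commute.one_right _).smul_right l)).symm
  set B := LinearMap.restrict (A : K →ₗ[ℂ] K) (hD.apply_mem_range hAT) with hB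
  have hBpow : ∀ (n : ℕ) w, ((B ^ n) w : K) = (A ^ n) (w : K) := by
    intro n
    induction n with
    | zero => intro w; rfl
    | succ n ih =>
      intro w
      rw [pow_succ, pow_succ, Module.End.mul_apply, ih, mul_apply_eq_comp]
      rfl
  filter_upwards [LinearMap.eventually_codisjoint_ker_pow_range_pow B] with n hn x
  have h1 : (⟨contourProj T z r x, x, rfl⟩ :
      contourSpace T z r) ∈
      LinearMap.ker (B ^ n) ⊔ LinearMap.range (B ^ n) := by
    rw [hn.eq_top]; trivial
  obtain ⟨u, hu, _, ⟨y, rfl⟩, huy⟩ := Submodule.mem_sup.1 h1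
  have h2 : (u : K) + (A ^ n) (y : K) = contourProj T z r x := by
    rw [← hBpow]
    exact congrArg Subtype.val huy
  -- `A (-q) = 1 - P` fixes every vector of the complementary range, and the two factors commute.
  have h3 : (A ^ n) (((-q) ^ n) (x - contourProj T z r x)) = x - contourProj T z r x := by
    rw [← mul_apply_eq_comp, ← hcq.mul_pow, hqA]
    have hfix : (1 - contourProj T z r) (x - contourProj T z r x) =
        x - contourProj T z r x := by
      rw [sub_apply, one_apply_eq_self, map_sub,
        hD.apply_apply, sub_self, sub_zero]
    clear hn hu huy h1 h2
    induction n with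
    | zero => rfl
    | succ n ih => rw [pow_succ, mul_apply_eq_comp, hfix, ih]
  refine ⟨u, mem_genSpace.2 ⟨n, ?_⟩, y + ((-q) ^ n) (x - contourProj T z r x), ?_⟩
  · rw [← hBpow, LinearMap.mem_ker.1 hu]
    rfl
  · rw [map_add, h3, ← add_assoc, h2]
    abel

theorem mem_resolventSet {l : ℂ} (hl : l ∈ ball z r) (h : genSpace T l = ⊥) :
    l ∈ resolventSet ℂ T := by
  rw [← isUnit_sub_smul_one, ContinuousLinearMap.isUnit_iff_bijective]
  obtain ⟨n, hn, hn1⟩ := ((hD.eventually_decomposition hl).and (eventually_ge_atTop 1)).exists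
  constructor
  · rw [injective_iff_map_eq_zero]
    intro v hv
    have : v ∈ genSpace T l := mem_genSpace.2 ⟨1, by rwa [pow_one]⟩
    rwa [h, Submodule.mem_bot] at this
  · intro x
    obtain ⟨u, hu, y, hy⟩ := hn x
    rw [h, Submodule.mem_bot] at hu
    refine ⟨((T - l • (1 : K →L[ℂ] K)) ^ (n - 1)) y, ?_⟩
    rw [← mul_apply_eq_comp, ← pow_succ', Nat.sub_add_cancel hn1, hy, hu, zero_add]

end IsFiniteDisc

/-- The annulus stays in the resolvent set by compactness, and two idempotents at distance less than
`1` bound each other's rank. -/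
theorem IsFiniteDisc.eventually {T : K →L[ℂ] K} {z : ℂ} {r R : ℝ} (hD : IsFiniteDisc T z r R) :
    ∀ᶠ T' in 𝓝 T, IsFiniteDisc T' z r R ∧
      Module.finrank ℂ (contourSpace T' z r) =
        Module.finrank ℂ (contourSpace T z r) := by
  have hc : IsCompact (closedBall z R \ ball z r) :=
    (isCompact_closedBall z R).diff isOpen_ball
  filter_upwards [eventually_resolvent_near hc hD.annulus one_pos,
    eventually_contourProj_near hD.pos hD.sphere_subset one_pos] with T' h1 h2
  have h3 : closedBall z R \ ball z r ⊆ resolventSet ℂ T' := fun w hw => (h1 w hw).1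
  have h0 : FiniteDimensional ℂ (LinearMap.range (contourProj T z r).toLinearMap) := hD.finite
  obtain ⟨h4, h5⟩ := finrank_range_le_of_norm_sub_lt_one (P := contourProj T z r)
    (contourProj_mul_self hD.pos hD.lt h3) (by rwa [norm_sub_rev])
  obtain ⟨-, h6⟩ := finrank_range_le_of_norm_sub_lt_one (P := contourProj T' z r)
    (contourProj_mul_self hD.pos hD.lt hD.annulus) h2
  exact ⟨⟨hD.pos, hD.lt, h3, h4⟩, le_antisymm h5 h6⟩

end Gen

/-! ### Inertia of the hermitian form on a finite-dimensional subspace -/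

section Form

variable {K : Type*} [NormedAddCommGroup K] [InnerProductSpace ℂ K]

/-- The form `⟪·, J ·⟫` is nondegenerate on `E`. -/
def IsNondegenerateOn (J : K →L[ℂ] K) (E : Submodule ℂ K) : Prop :=
  ∀ v ∈ E, (∀ u ∈ E, inner ℂ u (J v) = 0) → v = 0

/-- The compression of `J` to `E` is symmetric, so its eigenspaces for real eigenvalues span `E`;
nondegeneracy excludes the eigenvalue `0`. -/
theorem posIndex_add_negIndex {J : K →L[ℂ] K} (hJ : ∀ x y, inner ℂ (J x) y = inner ℂ x (J y))
    {E : Submodule ℂ K} [FiniteDimensional ℂ E] (hE : IsNondegenerateOn J E) :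
    posIndex J E + negIndex J E = Module.finrank ℂ E := by
  set B : E →ₗ[ℂ] E := (E.orthogonalProjectionOnto : K →ₗ[ℂ] E) ∘ₗ (J : K →ₗ[ℂ] K) ∘ₗ E.subtype
    with hB
  have hBapp : ∀ (w v : E), inner ℂ w (B v) = inner ℂ (w : K) (J v) := fun w v =>
    Submodule.inner_orthogonalProjectionOnto_eq_of_mem_left w (J v)
  have hBsymm : B.IsSymmetric := fun v w => by
    rw [hBapp, ← inner_conj_symm, hBapp, inner_conj_symm, hJ]
  have heig : ∀ μ : ℝ, formEigenspace J E μ =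
      (Module.End.eigenspace B (μ : ℂ)).map E.subtype := by
    intro μ
    ext v
    simp only [Submodule.mem_map, Module.End.mem_eigenspace_iff, Submodule.subtype_apply]
    constructor
    · rintro ⟨hv, h⟩
      refine ⟨⟨v, hv⟩, ext_inner_left ℂ fun w => ?_, rfl⟩
      rw [hBapp, inner_smul_right]
      exact h w w.2
    · rintro ⟨v, h, rfl⟩
      refine ⟨v.2, fun w hw => ?_⟩
      have := hBapp ⟨w, hw⟩ v
      rw [h, inner_smul_right] at this
      exact this.symm
  have hrank : ∀ μ : ℝ, Module.finrank ℂ (formEigenspace J E μ) =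
      Module.finrank ℂ (Module.End.eigenspace B (μ : ℂ)) := fun μ => by
    rw [heig, Submodule.finrank_map_subtype_eq]
  have hsup : (⨆ μ : ℝ, Module.End.eigenspace B (μ : ℂ)) = ⊤ := by
    have h1 := Submodule.orthogonal_eq_bot_iff.1 hBsymm.orthogonalComplement_iSup_eigenspaces_eq_bot
    rw [eq_top_iff, ← h1]
    refine iSup_le fun μ => ?_
    by_cases hμ : Module.End.HasEigenvalue B μ
    · obtain ⟨x, hx⟩ := Complex.conj_eq_iff_real.1 (hBsymm.conj_eigenvalue_eq_self hμ)
      rw [hx]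
      exact le_iSup (fun μ : ℝ => Module.End.eigenspace B (μ : ℂ)) x
    · rw [Module.End.hasEigenvalue_iff, not_not] at hμ
      rw [hμ]
      exact bot_le
  have hfin : FiniteDimensional ℂ (⨆ μ : ℝ, Module.End.eigenspace B (μ : ℂ) : Submodule ℂ E) :=
    inferInstance
  obtain ⟨h1, h2⟩ := finrank_iSup_eq_finsum
    ((Module.End.eigenspaces_iSupIndep B).comp Complex.ofReal_injective) hfin
  have h3 : Module.finrank ℂ E = ∑ᶠ μ : ℝ, Module.finrank ℂ (formEigenspace J E μ) := by
    rw [← finrank_top ℂ E, ← hsup]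
    refine h2.trans (finsum_congr fun μ => ?_)
    exact (hrank μ).symm
  have hsupp : (Function.support fun μ : ℝ =>
      Module.finrank ℂ (formEigenspace J E μ)).Finite := by
    refine h1.subset fun μ hμ h0 => hμ ?_
    change Module.End.eigenspace B (μ : ℂ) = ⊥ at h0
    beta_reduce
    rw [hrank, h0, finrank_bot]
  have hzero : Module.finrank ℂ (formEigenspace J E 0) = 0 := by
    have : formEigenspace J E 0 = ⊥ := (Submodule.eq_bot_iff _).2 fun v ⟨hv, h⟩ =>
      hE v hv fun u hu => by rw [h u hu, Complex.ofReal_zero, zero_mul]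
    rw [this, finrank_bot]
  rw [h3, posIndex, negIndex, ← finsum_mem_univ fun μ : ℝ =>
    Module.finrank ℂ (formEigenspace J E μ), ← finsum_mem_union' _
    (hsupp.subset inter_subset_right) (hsupp.subset inter_subset_right)]
  · refine finsum_mem_inter_support_eq' _ _ _ fun μ hμ => ⟨fun _ => mem_univ _, fun _ => ?_⟩
    rcases lt_trichotomy μ 0 with h | h | h
    · exact Or.inr h
    · subst h
      exact absurd hzero hμ
    · exact Or.inl h
  · rw [Set.disjoint_left]
    intro μ h h'
    exact lt_asymm (mem_Ioi.1 h) (mem_Iio.1 h')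

theorem posIndex_bot (J : K →L[ℂ] K) : posIndex J ⊥ = 0 := by
  have : ∀ μ, Module.finrank ℂ (formEigenspace J ⊥ μ) = 0 := fun μ => by
    rw [(Submodule.eq_bot_iff (formEigenspace J ⊥ μ)).2 fun v hv =>
      (Submodule.mem_bot ℂ).1 hv.1, finrank_bot]
  simp [posIndex, this]

theorem negIndex_bot (J : K →L[ℂ] K) : negIndex J ⊥ = 0 := by
  have : ∀ μ, Module.finrank ℂ (formEigenspace J ⊥ μ) = 0 := fun μ => by
    rw [(Submodule.eq_bot_iff (formEigenspace J ⊥ μ)).2 fun v hv =>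
      (Submodule.mem_bot ℂ).1 hv.1, finrank_bot]
  simp [negIndex, this]

end Form

/-! ### Riesz projections at isolated points -/

section Riesz

variable {K : Type*} [NormedAddCommGroup K] [InnerProductSpace ℂ K]

theorem IsIsolatingRadius.mono {T : K →L[ℂ] K} {z : ℂ} {r s : ℝ} (h : IsIsolatingRadius T z r)
    (hs : 0 < s) (hsr : s ≤ r) : IsIsolatingRadius T z s :=
  ⟨hs, fun _ hw => h.2 ⟨hw.1, closedBall_subset_closedBall hsr hw.2⟩⟩

theorem IsIsolatingRadius.annulus {T : K →L[ℂ] K} {z : ℂ} {r s : ℝ}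
    (h : IsIsolatingRadius T z r) (hs : 0 < s) :
    closedBall z r \ ball z s ⊆ resolventSet ℂ T := fun w hw => by
  by_contra hw'
  have : w = z := h.2 ⟨hw', hw.1⟩
  subst this
  exact hw.2 (mem_ball_self hs)

variable [CompleteSpace K]

theorem IsIsolatingRadius.contourProj_eq {T : K →L[ℂ] K} {z : ℂ} {r s : ℝ}
    (hr : IsIsolatingRadius T z r) (hs : IsIsolatingRadius T z s) :
    contourProj T z r = contourProj T z s := by
  rcases le_total r s with h | h
  · exact (contourProj_eq_of_annulus hr.1 h (hs.annulus hr.1)).symm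
  · exact contourProj_eq_of_annulus hs.1 h (hr.annulus hs.1)

/-- By Cauchy's theorem on the annulus, the arbitrary choice of radius in `rieszProj` does not
matter. -/
theorem IsIsolatingRadius.rieszProj_eq {T : K →L[ℂ] K} {z : ℂ} {r : ℝ}
    (h : IsIsolatingRadius T z r) : rieszProj T z = contourProj T z r := by
  have hex : ∃ r, IsIsolatingRadius T z r := ⟨r, h⟩
  rw [rieszProj, dif_pos hex]
  exact IsIsolatingRadius.contourProj_eq hex.choose_spec h

theorem IsIsolatingRadius.isFiniteDisc {T : K →L[ℂ] K} {z : ℂ} {r s : ℝ}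
    (h : IsIsolatingRadius T z r) (hs : 0 < s) (hsr : s < r)
    (hfin : FiniteDimensional ℂ (rieszSpace T z)) : IsFiniteDisc T z s r :=
  ⟨hs, hsr, h.annulus hs, by
    rwa [rieszSpace, (h.mono hs hsr.le).rieszProj_eq] at hfin⟩

theorem rieszProj_eq_zero {T : K →L[ℂ] K} {z : ℂ} (hz : z ∈ resolventSet ℂ T) :
    rieszProj T z = 0 := by
  rw [rieszProj]
  split_ifs with h
  · have h1 := h.choose_spec
    refine contourProj_eq_zero h1.1.le fun w hw => ?_
    by_contra hw'
    have : w = z := h1.2 ⟨hw', hw⟩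
    subst this
    exact hw' hz
  · rfl

theorem rieszSpace_eq_bot {T : K →L[ℂ] K} {z : ℂ} (hz : z ∈ resolventSet ℂ T) :
    rieszSpace T z = ⊥ := by
  rw [rieszSpace, rieszProj_eq_zero hz, ContinuousLinearMap.toLinearMap_zero, LinearMap.range_zero]

theorem IsIsolatingRadius.contourSpace_eq {T : K →L[ℂ] K} {z : ℂ} {r s : ℝ}
    (h : IsIsolatingRadius T z r) (hs : 0 < s) (hsr : s < r)
    (hfin : FiniteDimensional ℂ (rieszSpace T z)) : contourSpace T z s = genSpace T z := by
  have hD := h.isFiniteDisc hs hsr hfin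
  rw [hD.range_eq_iSup]
  refine le_antisymm (iSup_le fun l => ?_)
    (le_iSup (fun l : ball z s => genSpace T l) ⟨z, mem_ball_self hs⟩)
  by_cases hl : (l : ℂ) = z
  · rw [hl]
  · rw [genSpace_eq_bot]
    · exact bot_le
    · by_contra hl'
      exact hl (h.2 ⟨hl', closedBall_subset_closedBall hsr.le (ball_subset_closedBall l.2)⟩)

theorem exists_isIsolatingRadius {T : K →L[ℂ] K} {z : ℂ} (hz : z ∈ resolventSet ℂ T) :
    ∃ r, IsIsolatingRadius T z r := by
  obtain ⟨r, hr, hr'⟩ := Metric.nhds_basis_closedBall.mem_iff.1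
    ((spectrum.isOpen_resolventSet T).mem_nhds hz)
  exact ⟨r, hr, fun w hw => absurd (hr' hw.2) hw.1⟩

theorem rieszSpace_eq_genSpace {T : K →L[ℂ] K} {z : ℂ} (h : ∃ r, IsIsolatingRadius T z r)
    (hfin : FiniteDimensional ℂ (rieszSpace T z)) : rieszSpace T z = genSpace T z := by
  obtain ⟨r, hr⟩ := h
  have h2 : 0 < r / 2 := half_pos hr.1
  rw [← hr.contourSpace_eq h2 (half_lt_self hr.1) hfin, rieszSpace,
    (hr.mono h2 (half_le_self hr.1.le)).rieszProj_eq, contourSpace]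

end Riesz

/-! ### The pairing of eigenspaces under reflection in the unit circle -/

section Krein

variable {K : Type*} [NormedAddCommGroup K] [InnerProductSpace ℂ K] [CompleteSpace K]

/-- `T` is an invertible `J`-unitary for the symmetry `J`. -/
structure IsKreinUnitary (J T : K →L[ℂ] K) : Prop where
  adjoint_eq : ContinuousLinearMap.adjoint J = J
  sq_eq : J * J = 1
  isJUnitary : IsJUnitary J T
  isUnit : IsUnit T

namespace IsKreinUnitary

variable {J T : K →L[ℂ] K} (hT : IsKreinUnitary J T)
include hT

theorem isUnit_J : IsUnit J := ⟨⟨J, J, hT.sq_eq, hT.sq_eq⟩, rfl⟩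

theorem inner_symm (x y : K) : inner ℂ (J x) y = inner ℂ x (J y) := by
  rw [← ContinuousLinearMap.adjoint_inner_right, hT.adjoint_eq]

theorem sharp_mul : J * star T * J * T = 1 := by
  have := hT.isJUnitary
  rw [IsJUnitary, ← ContinuousLinearMap.star_eq_adjoint] at this
  rw [mul_assoc, mul_assoc, ← mul_assoc (star T), this, hT.sq_eq]

theorem mul_sharp : T * (J * star T * J) = 1 := by
  obtain ⟨u, hu⟩ := hT.isUnit
  have h := hT.sharp_mul
  rw [← hu] at h ⊢
  rw [eq_comm, ← Units.mul_inv_eq_iff_eq_mul, one_mul] at h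
  rw [← h, Units.mul_inv]

/-- Write `T⁻¹ = J T* J`. The `J`-adjoint of `T - l` is `T⁻¹ - conj l`, which equals `-conj l T⁻¹ (T
- m)` when `m = 1 / conj l`. -/
theorem star_sub_mul {l m : ℂ} (hlm : conj l * m = 1) :
    star (T - l • (1 : K →L[ℂ] K)) * J =
      J * ((-conj l) • (J * star T * J) * (T - m • (1 : K →L[ℂ] K))) := by
  have h1 : (-conj l) • (J * star T * J) * (T - m • (1 : K →L[ℂ] K)) =
      J * star T * J - conj l • (1 : K →L[ℂ] K) := by
    rw [mul_sub, smul_mul_assoc, hT.sharp_mul, smul_mul_smul_comm, mul_one, neg_mul, hlm, neg_smul,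
      neg_smul, one_smul]
    abel
  rw [h1, mul_sub, ← mul_assoc, ← mul_assoc, hT.sq_eq, one_mul, star_sub, star_smul, star_one,
    sub_mul, smul_mul_assoc, one_mul, mul_smul_comm, mul_one]
  rfl

theorem commute_sharp (m c : ℂ) :
    Commute (c • (J * star T * J)) (T - m • (1 : K →L[ℂ] K)) :=
  Commute.smul_left (Commute.sub_right (hT.sharp_mul.trans hT.mul_sharp.symm)
    ((Commute.one_right _).smul_right m)) c

theorem star_sub_pow_mul {l m : ℂ} (hlm : conj l * m = 1) (n : ℕ) :
    star ((T - l • (1 : K →L[ℂ] K)) ^ n) * J =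
      J * (((-conj l) • (J * star T * J)) ^ n * (T - m • (1 : K →L[ℂ] K)) ^ n) := by
  rw [← (hT.commute_sharp m _).mul_pow, star_pow]
  exact (SemiconjBy.pow_right (a := J) (hT.star_sub_mul hlm).symm n).symm

theorem mem_resolventSet {l m : ℂ} (hlm : conj l * m = 1) (hm : m ∈ resolventSet ℂ T) :
    l ∈ resolventSet ℂ T := by
  rw [← isUnit_sub_smul_one] at hm ⊢
  have hl : -conj l ≠ 0 := fun h => by
    rw [neg_eq_zero] at h
    rw [h, zero_mul] at hlm
    exact zero_ne_one hlm
  have h1 : IsUnit (J * star T * J) := ⟨⟨_, T, hT.sharp_mul, hT.mul_sharp⟩, rfl⟩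
  have h2 : IsUnit ((-conj l) • (J * star T * J)) := by
    rw [← Units.smul_mk0 hl]
    exact h1.smul _
  have h3 : IsUnit (star (T - l • (1 : K →L[ℂ] K)) * J * J) := by
    rw [hT.star_sub_mul hlm]
    exact (hT.isUnit_J.mul (h2.mul hm)).mul hT.isUnit_J
  rw [mul_assoc, hT.sq_eq, mul_one] at h3
  simpa using h3.star

/-- Taking `n` beyond the nilpotency order of `v` at `m`, the adjoint relation makes `J v`
orthogonal to the range of `(T - l)ⁿ`. Together with the generalized eigenspace at `l` this range
spans everything, so `J v = 0`. -/
theorem eq_zero_of_orthogonal {z l m : ℂ} {r R : ℝ} (hD : IsFiniteDisc T z r R)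
    (hl : l ∈ ball z r) (hlm : conj l * m = 1) {v : K} (hv : v ∈ genSpace T m)
    (h : ∀ u ∈ genSpace T l, inner ℂ u (J v) = 0) : v = 0 := by
  obtain ⟨k, hk⟩ := mem_genSpace.1 hv
  obtain ⟨n, hn, hkn⟩ := ((hD.eventually_decomposition hl).and (eventually_ge_atTop k)).exists
  have h0 : J v = 0 := by
    refine ext_inner_left ℂ fun x => ?_
    obtain ⟨u, hu, y, rfl⟩ := hn x
    rw [inner_add_left, h u hu, zero_add, inner_zero_right,
      ← ContinuousLinearMap.adjoint_inner_right, ← ContinuousLinearMap.star_eq_adjoint,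
      ← mul_apply_eq_comp, hT.star_sub_pow_mul hlm, mul_apply_eq_comp, mul_apply_eq_comp,
      pow_apply_eq_zero_of_le hkn hk, map_zero, map_zero, inner_zero_right]
  have h1 : (J * J) v = 0 := by rw [mul_apply_eq_comp, h0, map_zero]
  rwa [hT.sq_eq, one_apply_eq_self] at h1

/-- The orthogonal projection of `J v` onto the eigenspace at `l` depends injectively on `v`, by
nondegeneracy of the pairing. -/
theorem finrank_le {z l m : ℂ} {r R : ℝ} (hD : IsFiniteDisc T z r R)
    (hl : l ∈ ball z r) (hlm : conj l * m = 1) :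
    Module.finrank ℂ (genSpace T m) ≤ Module.finrank ℂ (genSpace T l) := by
  have := hD.finiteDimensional_genSpace hl
  refine LinearMap.finrank_le_finrank_of_injective
    (f := ((genSpace T l).orthogonalProjectionOnto : K →ₗ[ℂ] genSpace T l) ∘ₗ (J : K →ₗ[ℂ] K) ∘ₗ
      (genSpace T m).subtype) ?_
  rw [injective_iff_map_eq_zero]
  intro v hv
  refine Subtype.ext (hT.eq_zero_of_orthogonal hD hl hlm v.2 fun u hu => ?_)
  have h1 := Submodule.inner_orthogonalProjectionOnto_eq_of_mem_left (⟨u, hu⟩ : genSpace T l) (J v)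
  rw [← h1]
  exact (congrArg (inner ℂ (⟨u, hu⟩ : genSpace T l)) hv).trans (inner_zero_right _)

end IsKreinUnitary

/-- In infinite dimension `T* J T = J` only provides the left inverse `J T* J`. A resolvent point
`z` on the circle makes it two-sided, through `J T* J (T - z) = -z J (T - z)* J`. -/
theorem isUnit_of_isJUnitary {J T : K →L[ℂ] K}
    (hJ2 : J * J = 1) (hT : IsJUnitary J T) {z : ℂ} (hz : z ∈ sphere (0 : ℂ) 1)
    (hz' : z ∈ resolventSet ℂ T) : IsUnit T := by
  rw [← isUnit_sub_smul_one] at hz'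
  have hJu : IsUnit J := ⟨⟨J, J, hJ2, hJ2⟩, rfl⟩
  have hzz : z * conj z = 1 := by
    rw [Complex.mul_conj, Complex.normSq_eq_norm_sq, mem_sphere_zero_iff_norm.1 hz]; simp
  have hz0 : -z ≠ 0 := neg_ne_zero.2 fun h => by simp [h] at hzz
  have h1 : J * star T * J * T = 1 := by
    rw [IsJUnitary, ← ContinuousLinearMap.star_eq_adjoint] at hT
    rw [mul_assoc, mul_assoc, ← mul_assoc (star T), hT, hJ2]
  have h2 : J * star T * J * (T - z • (1 : K →L[ℂ] K)) =
      (-z) • (J * star (T - z • (1 : K →L[ℂ] K)) * J) := by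
    have h3 : J * star (T - z • (1 : K →L[ℂ] K)) * J =
        J * star T * J - conj z • (1 : K →L[ℂ] K) := by
      rw [star_sub, star_smul, star_one, mul_sub, sub_mul, mul_smul_comm, mul_one, smul_mul_assoc,
        hJ2]
      rfl
    rw [h3, mul_sub, h1, smul_sub, smul_smul, neg_mul, hzz, mul_smul_comm, mul_one, neg_smul,
      neg_smul, one_smul]
    abel
  have h4 : IsUnit (J * star T * J * (T - z • (1 : K →L[ℂ] K))) := by
    rw [h2, ← Units.smul_mk0 hz0]
    exact ((hJu.mul hz'.star).mul hJu).smul _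
  obtain ⟨u, hu⟩ := hz'
  rw [← hu] at h4
  have h5 : IsUnit (J * star T * J) := by
    have := h4.mul u⁻¹.isUnit
    rwa [Units.mul_inv_cancel_right] at this
  obtain ⟨w, hw⟩ := h5
  rw [← hw] at h1
  rw [← Units.mul_eq_one_iff_inv_eq.1 h1]
  exact w⁻¹.isUnit

theorem nuPos_eq_zero {J T : K →L[ℂ] K} {z : ℂ} (hz : z ∉ circleSpectrum T) : nuPos J T z = 0 := by
  rw [nuPos]
  split_ifs with h
  · rw [rieszSpace_eq_bot (by_contra fun h' => hz ⟨h', h⟩), posIndex_bot]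
  · rfl

theorem nuNeg_eq_zero {J T : K →L[ℂ] K} {z : ℂ} (hz : z ∉ circleSpectrum T) : nuNeg J T z = 0 := by
  rw [nuNeg]
  split_ifs with h
  · rw [rieszSpace_eq_bot (by_contra fun h' => hz ⟨h', h⟩), negIndex_bot]
  · rfl

theorem kreinSig_eq_zero {J T : K →L[ℂ] K} {z : ℂ} (hz : z ∉ circleSpectrum T) : kreinSig J T z = 0 := by
  rw [kreinSig, nuPos_eq_zero hz, nuNeg_eq_zero hz, sub_self]

/-! ### Gapped `J`-unitaries -/

namespace IsGappedJUnitary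

variable {J T : K →L[ℂ] K} (hT : IsGappedJUnitary J T)
include hT

theorem exists_isolating {z : ℂ} (hz : z ∈ sphere (0 : ℂ) 1) :
    (∃ r, IsIsolatingRadius T z r) ∧ FiniteDimensional ℂ (rieszSpace T z) := by
  by_cases h : z ∈ spectrum ℂ T
  · exact (hT.2 z ⟨h, hz⟩).2
  · have h' : z ∈ resolventSet ℂ T := not_not.1 h
    refine ⟨exists_isIsolatingRadius h', ?_⟩
    rw [rieszSpace_eq_bot h']
    infer_instance

theorem rieszSpace_eq {z : ℂ} (hz : z ∈ sphere (0 : ℂ) 1) : rieszSpace T z = genSpace T z :=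
  rieszSpace_eq_genSpace (hT.exists_isolating hz).1 (hT.exists_isolating hz).2

theorem exists_isFiniteDisc {z : ℂ} (hz : z ∈ sphere (0 : ℂ) 1) :
    ∃ r R, IsFiniteDisc T z r R := by
  obtain ⟨⟨r, hr⟩, hfin⟩ := hT.exists_isolating hz
  exact ⟨r / 2, r, hr.isFiniteDisc (half_pos hr.1) (half_lt_self hr.1) hfin⟩

theorem finite_circleSpectrum : (circleSpectrum T).Finite := by
  have hc : IsCompact (circleSpectrum T) :=
    (isCompact_sphere (0 : ℂ) 1).inter_left (spectrum.isClosed T)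
  have hr : ∀ z ∈ circleSpectrum T, ∃ r, IsIsolatingRadius T z r := fun z hz => (hT.2 z hz).2.1
  choose! r hr using hr
  obtain ⟨t, ht', ht⟩ := hc.elim_nhds_subcover (fun z => closedBall z (r z))
    fun z hz => closedBall_mem_nhds z (hr z hz).1
  refine t.finite_toSet.subset fun w hw => ?_
  obtain ⟨z, hz, hwz⟩ := mem_iUnion₂.1 (ht hw)
  have : w = z := (hr z (ht' z hz)).2 ⟨hw.1, hwz⟩
  rwa [this]

theorem isKreinUnitary (hJ : ContinuousLinearMap.adjoint J = J) (hJ2 : J * J = 1) :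
    IsKreinUnitary J T := by
  refine ⟨hJ, hJ2, hT.1, ?_⟩
  -- The circle is infinite and carries only finitely many spectral points, so it contains a
  -- resolvent point.
  have hinf : (sphere (0 : ℂ) 1).Infinite := by
    refine IsPreconnected.infinite_of_nontrivial (isPreconnected_sphere ?_ 0 1)
      ⟨1, by simp, -1, by simp, by norm_num⟩
    rw [Complex.rank_real_complex]
    exact Cardinal.one_lt_two
  obtain ⟨z, hz, hz'⟩ := (hinf.sdiff hT.finite_circleSpectrum).nonempty
  exact isUnit_of_isJUnitary hJ2 hT.1 hz (by_contra fun h => hz' ⟨h, hz⟩)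

theorem mem_circleSpectrum_iff {z : ℂ} :
    z ∈ circleSpectrum T ↔ z ∈ sphere (0 : ℂ) 1 ∧ genSpace T z ≠ ⊥ := by
  constructor
  · rintro ⟨h1, h2⟩
    refine ⟨h2, fun h => h1 ?_⟩
    obtain ⟨r, R, hD⟩ := hT.exists_isFiniteDisc h2
    exact hD.mem_resolventSet (mem_ball_self hD.pos) h
  · rintro ⟨h1, h2⟩
    exact ⟨fun h => h2 (genSpace_eq_bot h), h1⟩

theorem finiteDimensional_genSpace {z : ℂ} (hz : z ∈ sphere (0 : ℂ) 1) :
    FiniteDimensional ℂ (genSpace T z) := by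
  obtain ⟨r, R, hD⟩ := hT.exists_isFiniteDisc hz
  exact hD.finiteDimensional_genSpace (mem_ball_self hD.pos)

theorem nuPos_add_nuNeg (hJ : ContinuousLinearMap.adjoint J = J) (hJ2 : J * J = 1) {z : ℂ}
    (hz : z ∈ sphere (0 : ℂ) 1) : nuPos J T z + nuNeg J T z = Module.finrank ℂ (genSpace T z) := by
  have hK := hT.isKreinUnitary hJ hJ2
  have := hT.finiteDimensional_genSpace hz
  rw [nuPos, nuNeg, if_pos hz, if_pos hz, hT.rieszSpace_eq hz]
  refine posIndex_add_negIndex hK.inner_symm fun v hv h => ?_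
  obtain ⟨r, R, hD⟩ := hT.exists_isFiniteDisc hz
  refine hK.eq_zero_of_orthogonal hD (mem_ball_self hD.pos) ?_ hv h
  rw [mul_comm, Complex.mul_conj, Complex.normSq_eq_norm_sq, mem_sphere_zero_iff_norm.1 hz]
  simp

theorem kreinSig_cast (hJ : ContinuousLinearMap.adjoint J = J) (hJ2 : J * J = 1) {z : ℂ}
    (hz : z ∈ sphere (0 : ℂ) 1) :
    (kreinSig J T z : ZMod 2) = (Module.finrank ℂ (genSpace T z) : ZMod 2) := by
  rw [← hT.nuPos_add_nuNeg hJ hJ2 hz, kreinSig]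
  push_cast
  rw [sub_eq_add_neg, ZMod.neg_eq_self_mod_two]

theorem totalInertia_eq (hJ : ContinuousLinearMap.adjoint J = J) (hJ2 : J * J = 1) :
    totalInertia J T = ∑ᶠ z ∈ circleSpectrum T, Module.finrank ℂ (genSpace T z) :=
  finsum_mem_congr rfl fun _ hz => hT.nuPos_add_nuNeg hJ hJ2 hz.2

/-- The projection at one spectral point fixes its own generalized eigenspace and kills those at the
other points. -/
theorem rieszSpaceCircle_eq : rieszSpaceCircle T = ⨆ z : circleSpectrum T, genSpace T z := by
  have hsum : rieszProjCircle T = ∑ z ∈ hT.finite_circleSpectrum.toFinset, rieszProj T z :=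
    finsum_mem_eq_finite_toFinset_sum _ _
  refine le_antisymm ?_ (iSup_le fun z => ?_)
  · rintro _ ⟨v, rfl⟩
    change rieszProjCircle T v ∈ _
    rw [hsum, _root_.sum_apply]
    refine Submodule.sum_mem _ fun z hz => ?_
    have hz' : z ∈ circleSpectrum T := by simpa using hz
    refine Submodule.mem_iSup_of_mem (⟨z, hz'⟩ : circleSpectrum T) ?_
    rw [← hT.rieszSpace_eq hz'.2]
    exact ⟨v, rfl⟩
  · intro v hv
    refine ⟨v, ?_⟩
    change rieszProjCircle T v = v
    rw [hsum, _root_.sum_apply, Finset.sum_eq_single (z : ℂ)]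
    · obtain ⟨r, hr⟩ := (hT.2 z z.2).2.1
      rw [hr.rieszProj_eq]
      exact contourProj_apply_of_mem hr.1.le
        ((sphere_subset_annulus _ le_rfl).trans (hr.annulus hr.1)) (mem_ball_self hr.1) hv
    · intro w hw hwz
      have hw' : w ∈ circleSpectrum T := by simpa using hw
      obtain ⟨r, hr⟩ := (hT.2 w hw').2.1
      rw [hr.rieszProj_eq]
      refine contourProj_apply_of_notMem hr.1.le
        ((sphere_subset_annulus _ le_rfl).trans (hr.annulus hr.1)) (fun h => hwz ?_) hv
      exact (hr.2 ⟨z.2.1, ball_subset_closedBall h⟩).symm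
    · intro h
      exact absurd (hT.finite_circleSpectrum.mem_toFinset.2 z.2) h

theorem finiteDimensional_rieszSpaceCircle : FiniteDimensional ℂ (rieszSpaceCircle T) := by
  have := hT.finite_circleSpectrum.to_subtype
  have h : ∀ z : circleSpectrum T, FiniteDimensional ℂ (genSpace T z) := fun z =>
    hT.finiteDimensional_genSpace z.2.2
  rw [hT.rieszSpaceCircle_eq]
  infer_instance

theorem finrank_rieszSpaceCircle : Module.finrank ℂ (rieszSpaceCircle T) =
    ∑ᶠ z ∈ circleSpectrum T, Module.finrank ℂ (genSpace T z) := by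
  have h1 := hT.finiteDimensional_rieszSpaceCircle
  rw [hT.rieszSpaceCircle_eq] at h1 ⊢
  refine (finrank_iSup_eq_finsum ((iSupIndep_genSpace T).comp
    Subtype.val_injective) h1).2.trans ?_
  exact finsum_set_coe_eq_finsum_mem (f := fun l => Module.finrank ℂ (genSpace T l)) _

end IsGappedJUnitary

end Krein

/-! ### Antilinear maps and dimension -/

section Antilinear

theorem finrank_eq_of_antilinear {V W : Type*} [AddCommGroup V] [Module ℂ V] [AddCommGroup W]
    [Module ℂ W] (U : V →ₛₗ[starRingEnd ℂ] W) (hU : Function.Bijective U) :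
    Module.finrank ℂ V = Module.finrank ℂ W := by
  have h := lift_rank_eq_of_equiv_equiv (starRingEnd ℂ) (AddEquiv.ofBijective U.toAddMonoidHom hU)
    (starRingAut : ℂ ≃+* ℂ).bijective
    fun c v => U.map_smulₛₗ c v
  simpa [Module.finrank] using congrArg Cardinal.toNat h

/-- In a basis, `U` has a matrix `A` with `A conj(A) = -1`. Determinants give `|det A|² = (-1)ⁿ`,
which is impossible for odd `n`. -/
theorem even_finrank_of_quaternionic {V : Type*} [AddCommGroup V] [Module ℂ V]
    (U : V →ₛₗ[starRingEnd ℂ] V) (hU : ∀ v, U (U v) = -v) : Even (Module.finrank ℂ V) := by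
  by_cases hfin : FiniteDimensional ℂ V
  swap
  · rw [Module.finrank_of_not_finite hfin]
    exact Even.zero
  set b := Module.finBasis ℂ V with hb
  set A : Matrix (Fin (Module.finrank ℂ V)) (Fin (Module.finrank ℂ V)) ℂ :=
    Matrix.of fun i j => b.repr (U (b j)) i with hA
  have h1 : ∀ j, U (b j) = ∑ i, A i j • b i := fun j => (b.sum_repr (U (b j))).symm
  have h2 : A * A.map conj = -1 := by
    ext k j
    have h3 : b.repr (U (U (b j))) k = ∑ i, A k i * conj (A i j) := by
      rw [h1 j, map_sum, map_sum, Finsupp.finsetSum_apply]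
      refine Finset.sum_congr rfl fun i _ => ?_
      rw [U.map_smulₛₗ, map_smul, Finsupp.smul_apply, smul_eq_mul, mul_comm]
      rfl
    rw [Matrix.mul_apply]
    simp only [Matrix.map_apply]
    rw [← h3, hU, map_neg, Finsupp.neg_apply, Matrix.neg_apply, b.repr_self, Matrix.one_apply,
      Finsupp.single_apply]
    simp only [eq_comm]
  have h4 := congrArg Matrix.det h2
  rw [Matrix.det_mul, Matrix.det_neg, Matrix.det_one, mul_one, Fintype.card_fin,
    ← RingHom.mapMatrix_apply, ← RingHom.map_det, Complex.mul_conj] at h4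
  by_contra hodd
  rw [Nat.not_even_iff_odd] at hodd
  rw [hodd.neg_one_pow] at h4
  have h5 : Complex.normSq A.det = -1 := by exact_mod_cast h4
  linarith [Complex.normSq_nonneg A.det]

end Antilinear

/-! ### The antiunitary symmetry `C S` and its action on eigenspaces and forms -/

section Symmetry

variable {K : Type*} [NormedAddCommGroup K] [InnerProductSpace ℂ K]

theorem map_pow_sub {U : K →ₛₗ[starRingEnd ℂ] K} {T : K →L[ℂ] K} (hT : ∀ v, T (U v) = U (T v)) (l : ℂ) (n : ℕ) :
    ∀ v, ((T - conj l • (1 : K →L[ℂ] K)) ^ n) (U v) = U (((T - l • (1 : K →L[ℂ] K)) ^ n) v) := by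
  induction n with
  | zero => intro v; rfl
  | succ n ih =>
    intro v
    rw [pow_succ, pow_succ, mul_apply_eq_comp, mul_apply_eq_comp, ← ih]
    congr 1
    change T (U v) - conj l • U v = U (T v - l • v)
    rw [map_sub, hT, U.map_smulₛₗ]

theorem map_mem_genSpace {U : K →ₛₗ[starRingEnd ℂ] K} {T : K →L[ℂ] K} (hT : ∀ v, T (U v) = U (T v)) {l : ℂ} :
    ∀ v ∈ genSpace T l, U v ∈ genSpace T (conj l) := fun v hv => by
  obtain ⟨n, hn⟩ := mem_genSpace.1 hv
  exact mem_genSpace.2 ⟨n, by rw [map_pow_sub hT, hn, map_zero]⟩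

theorem map_mem_genSpace_conj {U : K →ₛₗ[starRingEnd ℂ] K} {T : K →L[ℂ] K} (hT : ∀ v, T (U v) = U (T v)) {l : ℂ} :
    ∀ v ∈ genSpace T (conj l), U v ∈ genSpace T l := fun v hv => by
  have := map_mem_genSpace hT v hv
  rwa [Complex.conj_conj] at this

/-- `U` is an antiunitary operator with `U² = η` and `J U = τ U J`. -/
structure IsAntiunitarySymmetry (U : K →ₛₗ[starRingEnd ℂ] K) (J : K →L[ℂ] K) (η τ : ℤˣ) :
    Prop where
  sq : ∀ v, U (U v) = (η : ℤ) • v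
  inner_map : ∀ v w, inner ℂ (U v) (U w) = conj (inner ℂ v w)
  map_J : ∀ v, J (U v) = (τ : ℤ) • U (J v)

namespace IsAntiunitarySymmetry

variable {U : K →ₛₗ[starRingEnd ℂ] K} {J : K →L[ℂ] K} {η τ : ℤˣ}
  (hU : IsAntiunitarySymmetry U J η τ)
include hU

theorem injective : Function.Injective U := fun v w h => by
  have h1 : (η : ℤ) • ((η : ℤ) • v) = (η : ℤ) • ((η : ℤ) • w) := by
    rw [← hU.sq v, ← hU.sq w, h]
  rwa [smul_smul, smul_smul, ← Units.val_mul, Int.units_mul_self, Units.val_one, one_smul,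
    one_smul] at h1

theorem finrank_eq {E F : Submodule ℂ K} (h1 : ∀ v ∈ E, U v ∈ F) (h2 : ∀ v ∈ F, U v ∈ E) :
    Module.finrank ℂ E = Module.finrank ℂ F := by
  refine finrank_eq_of_antilinear
    ({ toFun := fun v => ⟨U v, h1 v v.2⟩
       map_add' := fun v w => Subtype.ext (U.map_add v w)
       map_smul' := fun c v => Subtype.ext (U.map_smulₛₗ c v) } : E →ₛₗ[starRingEnd ℂ] F) ⟨?_, ?_⟩
  · intro v w h
    exact Subtype.ext (hU.injective (congrArg Subtype.val h))
  · intro w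
    refine ⟨⟨(η : ℤ) • U w, zsmul_mem (h2 w w.2) (η : ℤ)⟩, Subtype.ext ?_⟩
    change U ((η : ℤ) • U w) = w
    rw [map_zsmul, hU.sq, smul_smul, ← Units.val_mul, Int.units_mul_self, Units.val_one, one_smul]

theorem even_finrank (hη : η = -1) {E : Submodule ℂ K} (h1 : ∀ v ∈ E, U v ∈ E) :
    Even (Module.finrank ℂ E) := by
  refine even_finrank_of_quaternionic
    ({ toFun := fun v => ⟨U v, h1 v v.2⟩
       map_add' := fun v w => Subtype.ext (U.map_add v w)
       map_smul' := fun c v => Subtype.ext (U.map_smulₛₗ c v) } : E →ₛₗ[starRingEnd ℂ] E)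
    fun v => Subtype.ext ?_
  change U (U v) = -v
  rw [hU.sq, hη]
  simp

theorem inner_map_right (w x : K) : inner ℂ w (U x) = (η : ℤ) • inner ℂ x (U w) := by
  have h := hU.inner_map w (U x)
  rw [hU.sq] at h
  have h2 := congrArg conj h
  rw [Complex.conj_conj] at h2
  rw [← h2, inner_conj_symm, ← Int.cast_smul_eq_zsmul ℂ, ← Int.cast_smul_eq_zsmul ℂ,
    inner_smul_left]
  simp

theorem map_mem_formEigenspace {E F : Submodule ℂ K} (h1 : ∀ v ∈ E, U v ∈ F)
    (h2 : ∀ v ∈ F, U v ∈ E) {μ : ℝ} {v : K} (hv : v ∈ formEigenspace J E μ) :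
    U v ∈ formEigenspace J F (((τ : ℤ) : ℝ) * μ) := by
  refine ⟨h1 v hv.1, fun w hw => ?_⟩
  have h3 := congrArg conj (hv.2 (U w) (h2 w hw))
  rw [map_mul, inner_conj_symm, inner_conj_symm, Complex.conj_ofReal] at h3
  rw [hU.map_J, ← Int.cast_smul_eq_zsmul ℂ, inner_smul_right, hU.inner_map_right w (J v), h3,
    hU.inner_map_right w v]
  push_cast
  simp only [zsmul_eq_mul]
  ring

/-- For `τ = -1`, `U` exchanges the form eigenspaces for `μ` and `-μ`. -/
theorem posIndex_eq_negIndex (hτ : τ = -1) {E F : Submodule ℂ K} (h1 : ∀ v ∈ E, U v ∈ F)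
    (h2 : ∀ v ∈ F, U v ∈ E) : posIndex J E = negIndex J F := by
  refine finsum_mem_eq_of_bijOn (fun μ => -μ) ⟨fun μ hμ => ?_, neg_injective.injOn, fun μ hμ => ?_⟩
    fun μ _ => hU.finrank_eq (fun v hv => ?_) fun v hv => ?_
  · simpa using hμ
  · exact ⟨-μ, by simpa using hμ, neg_neg μ⟩
  · simpa [hτ] using hU.map_mem_formEigenspace h1 h2 hv
  · simpa [hτ] using hU.map_mem_formEigenspace h2 h1 hv

theorem finrank_genSpace_conj {T : K →L[ℂ] K} (hT : ∀ v, T (U v) = U (T v)) (l : ℂ) :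
    Module.finrank ℂ (genSpace T (conj l)) = Module.finrank ℂ (genSpace T l) :=
  (hU.finrank_eq (map_mem_genSpace hT) (map_mem_genSpace_conj hT)).symm

theorem even_finrank_genSpace (hη : η = -1) {T : K →L[ℂ] K} (hT : ∀ v, T (U v) = U (T v)) {l : ℂ}
    (hl : conj l = l) : Even (Module.finrank ℂ (genSpace T l)) :=
  hU.even_finrank hη fun v hv => by
    have := map_mem_genSpace hT v hv
    rwa [hl] at this

end IsAntiunitarySymmetry

/-- By polarization: an antilinear isometry preserves the norms of sums and differences, but swaps
the two terms containing `i`. -/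
theorem inner_antiunitary (C : K ≃ₗᵢ⋆[ℂ] K) (v w : K) :
    inner ℂ (C v) (C w) = conj (inner ℂ v w) := by
  have h1 : ∀ x : K, C (Complex.I • x) = -(Complex.I • C x) := fun x => by
    rw [C.map_smulₛₗ, Complex.conj_I, neg_smul]
  have h2 : ‖C v + C w‖ = ‖v + w‖ := by rw [← map_add, C.norm_map]
  have h3 : ‖C v - C w‖ = ‖v - w‖ := by rw [← map_sub, C.norm_map]
  have h4 : ‖C v + Complex.I • C w‖ = ‖v - Complex.I • w‖ := by
    rw [← C.norm_map (v - Complex.I • w), map_sub, h1, sub_neg_eq_add]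
  have h5 : ‖C v - Complex.I • C w‖ = ‖v + Complex.I • w‖ := by
    rw [← C.norm_map (v + Complex.I • w), map_add, h1, ← sub_eq_add_neg]
  rw [inner_eq_sum_norm_sq_div_four, inner_eq_sum_norm_sq_div_four]
  simp only [RCLike.I_to_complex, h2, h3, h4, h5, map_div₀, map_add, map_sub, map_mul, map_pow,
    Complex.conj_I, RCLike.ofReal_eq_complex_ofReal, Complex.conj_ofReal, map_ofNat]
  ring

variable [CompleteSpace K]

/-- The antiunitary operator `v ↦ C (S v)`. -/
noncomputable def realSymmetry (C : K ≃ₗᵢ⋆[ℂ] K) (S : K →L[ℂ] K) : K →ₛₗ[starRingEnd ℂ] K where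
  toFun v := C (S v)
  map_add' v w := by rw [map_add, map_add]
  map_smul' c v := by rw [map_smul, C.map_smulₛₗ]

variable {C : K ≃ₗᵢ⋆[ℂ] K} {J S : K →L[ℂ] K} {η τ : ℤˣ}

theorem IsRealKreinSpace.isAntiunitarySymmetry (hK : IsRealKreinSpace C J S η τ) :
    IsAntiunitarySymmetry (realSymmetry C S) J η τ where
  sq v := by
    have h1 : C (S (C (S v))) = S (S v) := congrArg (fun B : K →L[ℂ] K => B (S v)) hK.S_real
    have h2 : S (S v) = (η : ℤ) • v := congrArg (fun B : K →L[ℂ] K => B v) hK.S_sq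
    exact h1.trans h2
  inner_map v w := by
    have h1 : star S * S = 1 := hK.S_unitary.1
    change inner ℂ (C (S v)) (C (S w)) = _
    rw [inner_antiunitary, ← ContinuousLinearMap.adjoint_inner_right,
      ← ContinuousLinearMap.star_eq_adjoint, ← mul_apply_eq_comp, h1, one_apply_eq_self]
  map_J v := by
    have h1 : C (J (C (C (S v)))) = J (C (S v)) :=
      congrArg (fun B : K →L[ℂ] K => B (C (S v))) hK.J_real
    have h2 : J (S v) = (τ : ℤ) • S (J v) := congrArg (fun B : K →L[ℂ] K => B v) hK.J_mul_S
    change J (C (S v)) = (τ : ℤ) • C (S (J v))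
    rw [← h1, hK.conj_conj, h2, map_zsmul]

theorem IsRealKreinSpace.apply_realSymmetry (hK : IsRealKreinSpace C J S η τ) {T : K →L[ℂ] K}
    (hT : T ∈ gappedRealJUnitaries C J S) (v : K) :
    T (realSymmetry C S v) = realSymmetry C S (T v) := by
  have h1 : S * star S = 1 := hK.S_unitary.2
  have h2 : conjOp C T * S = S * T := by
    have := congrArg (fun B => S * B) hT.2
    rw [← ContinuousLinearMap.star_eq_adjoint] at this
    simpa only [← mul_assoc, h1, one_mul] using this
  have h3 : C (T (C (S v))) = S (T v) := congrArg (fun B : K →L[ℂ] K => B v) h2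
  change T (C (S v)) = C (S (T v))
  rw [← h3, hK.conj_conj]

end Symmetry

/-! ### Parity of sums invariant under an involution -/

section Counting

theorem sum_eq_zero_zmod_two_of_involution {s : Finset ℂ} {f : ℂ → ℕ} (g : ℂ → ℂ)
    (hg : ∀ l ∈ s, g l ∈ s) (hgg : ∀ l ∈ s, g (g l) = l) (hf : ∀ l ∈ s, f (g l) = f l)
    (hfix : ∀ l ∈ s, g l = l → Even (f l)) : ((∑ l ∈ s, f l : ℕ) : ZMod 2) = 0 := by
  rw [Nat.cast_sum]
  refine Finset.sum_involution (fun l _ => g l) (fun l hl => ?_) (fun l hl h0 h => h0 ?_) hg hgg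
  · rw [hf l hl]
    exact CharTwo.add_self_eq_zero _
  · exact (ZMod.natCast_eq_zero_iff_even).2 (hfix l hl h)

theorem even_sum_of_conj {s : Finset ℂ} {f : ℂ → ℕ} (hs : ∀ l ∈ s, conj l ∈ s)
    (hf : ∀ l ∈ s, f (conj l) = f l) (hfix : ∀ l ∈ s, conj l = l → Even (f l)) :
    Even (∑ l ∈ s, f l) :=
  ZMod.natCast_eq_zero_iff_even.1
    (sum_eq_zero_zmod_two_of_involution _ hs (fun l _ => Complex.conj_conj l) hf hfix)

end Counting

/-! ### Reflection symmetry inside small discs centred on the circle -/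

section Discs

/-- Since `‖l‖ ‖m - z‖ = ‖l - z‖` and `‖l‖ ≥ 1/2`, reflection at most doubles the distance to `z`;
the factor `4` leaves room to spare. -/
theorem inv_conj_mem_ball {z l m : ℂ} {ρ : ℝ} (hz : z ∈ sphere (0 : ℂ) 1) (hρ : 0 < ρ)
    (hρ' : ρ ≤ 1 / 2) (hl : l ∈ ball z (ρ / 4)) (hlm : conj l * m = 1) : m ∈ ball z ρ := by
  rw [mem_sphere_zero_iff_norm] at hz
  rw [mem_ball, dist_eq_norm] at hl ⊢
  have h1 : conj z * z = 1 := by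
    rw [mul_comm, Complex.mul_conj, Complex.normSq_eq_norm_sq, hz]; simp
  have h2 : conj l * (m - z) = conj (z - l) * z := by
    rw [map_sub, mul_sub, sub_mul, hlm, h1]
  have h3 : ‖l‖ * ‖m - z‖ = ‖l - z‖ := by
    have := congrArg norm h2
    rwa [norm_mul, norm_mul, Complex.norm_conj, Complex.norm_conj, hz, mul_one,
      norm_sub_rev z l] at this
  have h4 : 1 / 2 ≤ ‖l‖ := by
    have := norm_sub_norm_le z l
    rw [norm_sub_rev, hz] at this
    linarith
  have h5 := norm_nonneg (m - z)
  nlinarith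

theorem conj_mem_ball {z l : ℂ} {r : ℝ} (hl : l ∈ ball z r) : conj l ∈ ball (conj z) r := by
  rw [mem_ball, dist_eq_norm] at hl ⊢
  rwa [← map_sub, Complex.norm_conj]

variable {K : Type*} [NormedAddCommGroup K] [InnerProductSpace ℂ K] {J T : K →L[ℂ] K}

theorem genSpace_ne_bot {l : ℂ} (h : Module.finrank ℂ (genSpace T l) ≠ 0) : genSpace T l ≠ ⊥ :=
  fun h' => h (by rw [h', finrank_bot])

theorem exists_common_isIsolatingRadius {s : Set ℂ} (hs : s.Finite)
    (h : ∀ z ∈ s, ∃ r, IsIsolatingRadius T z r) :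
    ∃ ρ, 0 < ρ ∧ ρ ≤ 1 / 2 ∧ ∀ z ∈ s, IsIsolatingRadius T z ρ := by
  have h1 : ∀ᶠ ρ in 𝓝[>] (0 : ℝ), ∀ z ∈ s, IsIsolatingRadius T z ρ := by
    rw [hs.eventually_all]
    intro z hz
    obtain ⟨r, hr⟩ := h z hz
    filter_upwards [Ioc_mem_nhdsGT hr.1] with ρ hρ
    exact hr.mono hρ.1 hρ.2
  obtain ⟨ρ, h2, h3⟩ := (h1.and (Ioc_mem_nhdsGT (half_pos (zero_lt_one' ℝ)))).exists
  exact ⟨ρ, h3.1, h3.2, h2⟩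

variable [CompleteSpace K]

/-- Reflection may enlarge the disc, but `m` is spectral and still within `ρ` of `z`. The annulus
between `ρ / 4` and `ρ` is free of spectrum, so `m` falls back into the small disc. -/
theorem IsKreinUnitary.finrank_genSpace_inv_conj (hT : IsKreinUnitary J T) {z : ℂ} {ρ : ℝ}
    (hz : z ∈ sphere (0 : ℂ) 1) (hρ' : ρ ≤ 1 / 2) (hD : IsFiniteDisc T z (ρ / 4) ρ) {l m : ℂ}
    (hl : l ∈ ball z (ρ / 4)) (hlm : conj l * m = 1)
    (h0 : Module.finrank ℂ (genSpace T l) ≠ 0) :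
    m ∈ ball z (ρ / 4) ∧ Module.finrank ℂ (genSpace T m) = Module.finrank ℂ (genSpace T l) := by
  have hρ : 0 < ρ := by linarith [hD.pos]
  have h1 := inv_conj_mem_ball hz hρ hρ' hl hlm
  have h2 : m ∉ resolventSet ℂ T := fun h =>
    genSpace_ne_bot h0 (genSpace_eq_bot (hT.mem_resolventSet hlm h))
  have h3 : m ∈ ball z (ρ / 4) := by
    by_contra h
    exact h2 (hD.annulus ⟨ball_subset_closedBall h1, h⟩)
  have hml : conj m * l = 1 := by
    have := congrArg conj hlm
    rwa [map_mul, Complex.conj_conj, map_one, mul_comm] at this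
  exact ⟨h3, le_antisymm (hT.finrank_le hD hl hlm) (hT.finrank_le hD h3 hml)⟩

namespace IsFiniteDisc

variable {z : ℂ} {r R : ℝ} (hD : IsFiniteDisc T z r R)
include hD

theorem finite_finrank_ne_zero :
    {l ∈ ball z r | Module.finrank ℂ (genSpace T l) ≠ 0}.Finite :=
  hD.finite_support.subset fun _ hl => ⟨hl.1, genSpace_ne_bot hl.2⟩

theorem finrank_contourSpace : Module.finrank ℂ (contourSpace T z r) =
    ∑ l ∈ hD.finite_finrank_ne_zero.toFinset, Module.finrank ℂ (genSpace T l) := by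
  rw [hD.finrank_range]
  refine finsum_mem_eq_sum_of_subset _ (fun l hl => ?_) fun l hl => ?_
  · simpa using hl
  · exact ((Finite.mem_toFinset _).1 hl).1

end IsFiniteDisc

theorem IsIsolatingRadius.eventually_isFiniteDisc {z : ℂ} {ρ : ℝ} (h : IsIsolatingRadius T z ρ)
    (hfin : FiniteDimensional ℂ (rieszSpace T z)) :
    ∀ᶠ T' in 𝓝 T, IsFiniteDisc T' z (ρ / 4) ρ ∧
      Module.finrank ℂ (contourSpace T' z (ρ / 4)) = Module.finrank ℂ (genSpace T z) := by
  have h1 : 0 < ρ / 4 := by linarith [h.1]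
  have h2 : ρ / 4 < ρ := by linarith [h.1]
  rw [← h.contourSpace_eq h1 h2 hfin]
  exact (h.isFiniteDisc h1 h2 hfin).eventually

end Discs

/-! ### Vanishing, parity and local constancy of the invariants -/

section Main

variable {K : Type*} [NormedAddCommGroup K] [InnerProductSpace ℂ K] [CompleteSpace K]
  {C : K ≃ₗᵢ⋆[ℂ] K} {J S : K →L[ℂ] K} {η τ : ℤˣ}

namespace IsGappedJUnitary

variable {T : K →L[ℂ] K} (hT : IsGappedJUnitary J T)
include hT

theorem mem_circleSpectrum_iff_finrank {z : ℂ} : z ∈ circleSpectrum T ↔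
    z ∈ sphere (0 : ℂ) 1 ∧ Module.finrank ℂ (genSpace T z) ≠ 0 := by
  rw [hT.mem_circleSpectrum_iff]
  refine and_congr_right fun hz => ?_
  have := hT.finiteDimensional_genSpace hz
  rw [Ne, Ne, Submodule.finrank_eq_zero]

theorem globalSig_eq_sum : globalSig J T =
    ∑ z ∈ hT.finite_circleSpectrum.toFinset, kreinSig J T z := by
  refine finsum_mem_eq_sum_of_subset _ (fun z hz => ?_) fun z hz => ?_
  · by_contra h
    exact hz.2 (kreinSig_eq_zero (by simpa using h))
  · exact ((Finite.mem_toFinset _).1 hz).2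

end IsGappedJUnitary

namespace IsRealKreinSpace

variable (hK : IsRealKreinSpace C J S η τ)
include hK

section Single

variable {T : K →L[ℂ] K} (hT : T ∈ gappedRealJUnitaries C J S)
include hT

theorem isKreinUnitary : IsKreinUnitary J T := hT.1.isKreinUnitary hK.J_adjoint hK.J_sq

theorem finrank_genSpace_conj (l : ℂ) :
    Module.finrank ℂ (genSpace T (conj l)) = Module.finrank ℂ (genSpace T l) :=
  hK.isAntiunitarySymmetry.finrank_genSpace_conj (hK.apply_realSymmetry hT) l

theorem even_finrank_genSpace (hη : η = -1) {l : ℂ} (hl : conj l = l) :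
    Even (Module.finrank ℂ (genSpace T l)) :=
  hK.isAntiunitarySymmetry.even_finrank_genSpace hη (hK.apply_realSymmetry hT) hl

theorem conj_mem_circleSpectrum {z : ℂ} (hz : z ∈ circleSpectrum T) :
    conj z ∈ circleSpectrum T := by
  rw [hT.1.mem_circleSpectrum_iff_finrank] at hz ⊢
  rw [hK.finrank_genSpace_conj hT]
  exact ⟨by simpa using hz.1, hz.2⟩

theorem sec_eq : sec J T = (Module.finrank ℂ (genSpace T 1) : ZMod 2) :=
  hT.1.kreinSig_cast hK.J_adjoint hK.J_sq (by simp)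

theorem totalInertia_eq_sum : totalInertia J T =
    ∑ z ∈ hT.1.finite_circleSpectrum.toFinset, Module.finrank ℂ (genSpace T z) := by
  rw [hT.1.totalInertia_eq hK.J_adjoint hK.J_sq]
  exact finsum_mem_eq_finite_toFinset_sum _ _

theorem even_sum_circleSpectrum (hη : η = -1) : Even
    (∑ z ∈ hT.1.finite_circleSpectrum.toFinset, Module.finrank ℂ (genSpace T z)) :=
  even_sum_of_conj (fun l hl => by simpa using hK.conj_mem_circleSpectrum hT (by simpa using hl))
    (fun l _ => hK.finrank_genSpace_conj hT l) fun l _ hl => hK.even_finrank_genSpace hT hη hl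

theorem even_totalInertia (hη : η = -1) : Even (totalInertia J T) := by
  rw [hK.totalInertia_eq_sum hT]
  exact hK.even_sum_circleSpectrum hT hη

/-- Modulo `2` the signature is the total dimension on the circle, where conjugate points pair off
and real points contribute even dimensions. -/
theorem even_globalSig (hη : η = -1) : Even (globalSig J T) := by
  have h : (globalSig J T : ZMod 2) = 0 := by
    rw [hT.1.globalSig_eq_sum, Int.cast_sum, Finset.sum_congr rfl fun z hz =>
      hT.1.kreinSig_cast hK.J_adjoint hK.J_sq ((Finite.mem_toFinset _).1 hz).2, ← Nat.cast_sum]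
    exact ZMod.natCast_eq_zero_iff_even.2 (hK.even_sum_circleSpectrum hT hη)
  exact (ZMod.intCast_eq_zero_iff_even).1 h

theorem kreinSig_conj (hτ : τ = -1) (z : ℂ) : kreinSig J T (conj z) = -kreinSig J T z := by
  by_cases hz : z ∈ sphere (0 : ℂ) 1
  · have hz' : conj z ∈ sphere (0 : ℂ) 1 := by simpa using hz
    have hU := hK.isAntiunitarySymmetry
    have hc := hK.apply_realSymmetry hT
    rw [kreinSig, kreinSig, nuPos, nuNeg, nuPos, nuNeg, if_pos hz, if_pos hz, if_pos hz',
      if_pos hz', hT.1.rieszSpace_eq hz, hT.1.rieszSpace_eq hz',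
      hU.posIndex_eq_negIndex hτ (map_mem_genSpace hc (l := z)) (map_mem_genSpace_conj hc),
      hU.posIndex_eq_negIndex hτ (map_mem_genSpace_conj hc (l := z)) (map_mem_genSpace hc)]
    ring
  · rw [kreinSig_eq_zero fun h => hz h.2, kreinSig_eq_zero fun h => hz (by simpa using h.2), neg_zero]

theorem globalSig_eq_zero (hτ : τ = -1) : globalSig J T = 0 := by
  have h1 : globalSig J T = -globalSig J T := by
    nth_rewrite 1 [hT.1.globalSig_eq_sum]
    rw [hT.1.globalSig_eq_sum, ← Finset.sum_neg_distrib]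
    refine Finset.sum_nbij' (fun z => conj z) (fun z => conj z) ?_ ?_ (by simp) (by simp) ?_
    · exact fun z hz => by simpa using hK.conj_mem_circleSpectrum hT (by simpa using hz)
    · exact fun z hz => by simpa using hK.conj_mem_circleSpectrum hT (by simpa using hz)
    · intro z _
      rw [hK.kreinSig_conj hT hτ, neg_neg]
  omega

end Single

theorem isLocallyConstant_sec :
    IsLocallyConstant fun T : gappedRealJUnitaries C J S => sec J (T : K →L[ℂ] K) := by
  rw [IsLocallyConstant.iff_eventually_eq]
  rintro ⟨T₀, hT₀⟩
  have h1 : (1 : ℂ) ∈ sphere (0 : ℂ) 1 := by simp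
  obtain ⟨hr, hfin⟩ := hT₀.1.exists_isolating h1
  obtain ⟨ρ, hρ, hρ', hiso⟩ := exists_common_isIsolatingRadius (finite_singleton (1 : ℂ))
    (T := T₀) (by simpa using hr)
  refine (continuous_subtype_val.tendsto _).eventually
    ((hiso 1 rfl).eventually_isFiniteDisc hfin) |>.mono ?_
  rintro ⟨T, hT⟩ ⟨hD, hrank⟩
  change sec J T = sec J T₀
  rw [hK.sec_eq hT, hK.sec_eq hT₀, ← hrank, hD.finrank_contourSpace]
  set f := fun l => Module.finrank ℂ (genSpace T l) with hf
  set s := hD.finite_finrank_ne_zero.toFinset with hs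
  have hmem : ∀ l, l ∈ s ↔ l ∈ ball (1 : ℂ) (ρ / 4) ∧ f l ≠ 0 := fun l => by simp [hs, hf]
  have hconj : ∀ l ∈ s, conj l ∈ s := fun l hl => by
    rw [hmem] at hl ⊢
    refine ⟨by simpa using conj_mem_ball hl.1, ?_⟩
    rw [hf]
    beta_reduce
    rw [hK.finrank_genSpace_conj hT]
    exact hl.2
  -- Keeps `0` and `-1` out of the disc, leaving `1` as the only possible fixed point of inversion.
  have hre : ∀ l ∈ s, 0 < l.re := fun l hl => by
    have h2 := ((hmem l).1 hl).1
    rw [mem_ball, dist_eq_norm] at h2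
    have h3 := (abs_le.1 ((Complex.abs_re_le_norm (l - 1)))).1
    rw [Complex.sub_re, Complex.one_re] at h3
    linarith
  have hinv : ∀ l ∈ s, conj l⁻¹ ∈ s ∧ f (conj l⁻¹) = f l := fun l hl => by
    have hl0 : conj l ≠ 0 := fun h => by
      have := hre l hl
      rw [map_eq_zero] at h
      simp [h] at this
    obtain ⟨h2, h3⟩ := (hmem l).1 hl
    obtain ⟨h4, h5⟩ := (hK.isKreinUnitary hT).finrank_genSpace_inv_conj h1 hρ' hD h2
      (m := conj l⁻¹) (by rw [map_inv₀, mul_inv_cancel₀ hl0]) h3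
    exact ⟨(hmem _).2 ⟨h4, by rw [hf]; beta_reduce; rw [h5]; exact h3⟩, h5⟩
  -- The involution is inversion at real points and conjugation elsewhere. It has no fixed point
  -- once `1` is removed.
  have hsum : ((∑ l ∈ s.erase 1, f l : ℕ) : ZMod 2) = 0 := by
    refine sum_eq_zero_zmod_two_of_involution (fun l => if conj l = l then conj l⁻¹ else conj l)
      (fun l hl => ?_) (fun l hl => ?_) (fun l hl => ?_) fun l hl => ?_
    all_goals
      obtain ⟨hl1, hl⟩ := Finset.mem_erase.1 hl
      by_cases hreal : conj l = l
    · rw [if_pos hreal]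
      refine Finset.mem_erase.2 ⟨fun h => hl1 ?_, (hinv l hl).1⟩
      rwa [map_inv₀, hreal, inv_eq_one] at h
    · rw [if_neg hreal]
      refine Finset.mem_erase.2 ⟨fun h => hl1 ?_, hconj l hl⟩
      rw [← Complex.conj_conj l, h, map_one]
    · rw [if_pos hreal, map_inv₀, hreal, map_inv₀, hreal, if_pos rfl, inv_inv, hreal]
    · rw [if_neg hreal, Complex.conj_conj, if_neg fun h => hreal h.symm]
    · rw [if_pos hreal]
      exact (hinv l hl).2
    · rw [if_neg hreal]
      exact hK.finrank_genSpace_conj hT l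
    · rw [if_pos hreal, map_inv₀, hreal]
      intro h
      have hl0 : l ≠ 0 := fun h => by
        have := hre l hl
        simp [h] at this
      have h2 : l * l = 1 := by
        nth_rewrite 1 [← h]
        exact inv_mul_cancel₀ hl0
      rcases mul_self_eq_one_iff.1 h2 with h3 | h3
      · exact absurd h3 hl1
      · have := hre l hl
        rw [h3] at this
        norm_num at this
    · rw [if_neg hreal]
      exact fun h => absurd h hreal
  change ((f 1 : ℕ) : ZMod 2) = ((∑ l ∈ s, f l : ℕ) : ZMod 2)
  by_cases h : 1 ∈ s
  · rw [← Finset.add_sum_erase s f h, Nat.cast_add, hsum, add_zero]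
  · rw [← Finset.erase_eq_of_notMem h, hsum]
    have : f 1 = 0 := by
      by_contra h0
      exact h ((hmem 1).2 ⟨mem_ball_self hD.pos, h0⟩)
    rw [this, Nat.cast_zero]

theorem isLocallyConstant_sig₂ (hη : η = -1) :
    IsLocallyConstant fun T : gappedRealJUnitaries C J S => sig₂ J (T : K →L[ℂ] K) := by
  rw [IsLocallyConstant.iff_eventually_eq]
  rintro ⟨T₀, hT₀⟩
  have hZ := hT₀.1.finite_circleSpectrum
  obtain ⟨ρ, hρ, hρ', hiso⟩ := exists_common_isIsolatingRadius hZ fun z hz => (hT₀.1.2 z hz).2.1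
  have hev1 : ∀ᶠ T in 𝓝 T₀, ∀ z ∈ circleSpectrum T₀, IsFiniteDisc T z (ρ / 4) ρ ∧
      Module.finrank ℂ (contourSpace T z (ρ / 4)) = Module.finrank ℂ (genSpace T₀ z) := by
    rw [hZ.eventually_all]
    exact fun z hz => (hiso z hz).eventually_isFiniteDisc (hT₀.1.2 z hz).2.2
  -- No circle spectrum can appear outside the discs: the rest of the circle is compact and consists
  -- of resolvent points of `T₀`.
  have hev2 : ∀ᶠ T in 𝓝 T₀,
      ∀ w ∈ sphere (0 : ℂ) 1 \ ⋃ z ∈ circleSpectrum T₀, ball z (ρ / 4), w ∈ resolventSet ℂ T := by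
    refine (eventually_resolvent_near ((isCompact_sphere (0 : ℂ) 1).diff
      (isOpen_biUnion fun z _ => isOpen_ball)) (fun w hw => ?_) one_pos).mono
      fun T h w hw => (h w hw).1
    by_contra h
    exact hw.2 (mem_biUnion (show w ∈ circleSpectrum T₀ from ⟨h, hw.1⟩)
      (mem_ball_self (by positivity)))
  refine (continuous_subtype_val.tendsto _).eventually (hev1.and hev2) |>.mono ?_
  rintro ⟨T, hT⟩ ⟨hD, hres⟩
  change sig₂ J T = sig₂ J T₀
  classical
  set f := fun l => Module.finrank ℂ (genSpace T l) with hf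
  have hfinite : {l ∈ ⋃ z ∈ circleSpectrum T₀, ball z (ρ / 4) | f l ≠ 0}.Finite := by
    refine (hZ.biUnion fun z hz => (hD z hz).1.finite_finrank_ne_zero).subset ?_
    rintro l ⟨hl, hl'⟩
    obtain ⟨z, hz, hlz⟩ := mem_iUnion₂.1 hl
    exact mem_biUnion hz ⟨hlz, hl'⟩
  set s := hfinite.toFinset with hs
  have hmem : ∀ l, l ∈ s ↔ (∃ z ∈ circleSpectrum T₀, l ∈ ball z (ρ / 4)) ∧ f l ≠ 0 := fun l => by
    simp [hs]
  have htotal : totalInertia J T₀ = ∑ l ∈ s, f l := by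
    rw [hK.totalInertia_eq_sum hT₀]
    have h1 : s = hZ.toFinset.biUnion fun z => {l ∈ s | l ∈ ball z (ρ / 4)} := by
      ext l
      simp only [Finset.mem_biUnion, Finset.mem_filter, Finite.mem_toFinset]
      refine ⟨fun hl => ?_, fun ⟨_, _, hl, _⟩ => hl⟩
      obtain ⟨⟨z, hz, hlz⟩, -⟩ := (hmem l).1 hl
      exact ⟨z, hz, hl, hlz⟩
    rw [h1, Finset.sum_biUnion]
    · refine Finset.sum_congr rfl fun z hz => ?_
      have hz' := (Finite.mem_toFinset _).1 hz
      rw [← (hD z hz').2, (hD z hz').1.finrank_contourSpace]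
      refine Finset.sum_congr ?_ fun _ _ => rfl
      ext l
      simp only [Finite.mem_toFinset, Finset.mem_filter, hmem]
      exact ⟨fun h => ⟨⟨⟨z, hz', h.1⟩, h.2⟩, h.1⟩, fun h => ⟨h.2, h.1.2⟩⟩
    -- The discs are disjoint: a common point would put `z` within `ρ / 2` of `w`, against the
    -- isolating radius `ρ`.
    · intro z hz w hw hzw
      refine Finset.disjoint_left.2 fun l hl hl' => hzw ?_
      have h2 := mem_ball.1 (Finset.mem_filter.1 hl).2
      have h3 := mem_ball.1 (Finset.mem_filter.1 hl').2
      have hz' : z ∈ circleSpectrum T₀ := by simpa using hz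
      have hw' : w ∈ circleSpectrum T₀ := by simpa using hw
      refine (hiso w hw').2 ⟨hz'.1, ?_⟩
      rw [mem_closedBall]
      have := dist_triangle_left z w l
      linarith
  have hconj : ∀ l ∈ s, conj l ∈ s := fun l hl => by
    obtain ⟨⟨z, hz, hlz⟩, hl0⟩ := (hmem l).1 hl
    refine (hmem _).2 ⟨⟨conj z, hK.conj_mem_circleSpectrum hT₀ hz, conj_mem_ball hlz⟩, ?_⟩
    rw [hf]
    beta_reduce
    rwa [hK.finrank_genSpace_conj hT]
  have hne : ∀ l ∈ s, l ≠ 0 := fun l hl h => by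
    obtain ⟨⟨z, hz, hlz⟩, -⟩ := (hmem l).1 hl
    have h2 := mem_sphere_zero_iff_norm.1 hz.2
    rw [mem_ball, dist_eq_norm, h, zero_sub, norm_neg, h2] at hlz
    linarith
  have hinv : ∀ l ∈ s, conj l⁻¹ ∈ s ∧ f (conj l⁻¹) = f l := fun l hl => by
    have hl0 : conj l ≠ 0 := fun h => hne l hl (by simpa using h)
    obtain ⟨⟨z, hz, h2⟩, h3⟩ := (hmem l).1 hl
    obtain ⟨h4, h5⟩ := (hK.isKreinUnitary hT).finrank_genSpace_inv_conj hz.2 hρ' (hD z hz).1 h2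
      (m := conj l⁻¹) (by rw [map_inv₀, mul_inv_cancel₀ hl0]) h3
    exact ⟨(hmem _).2 ⟨⟨z, hz, h4⟩, by rw [hf]; beta_reduce; rw [h5]; exact h3⟩, h5⟩
  have hon : totalInertia J T = ∑ l ∈ s with ‖l‖ = 1, f l := by
    rw [hK.totalInertia_eq_sum hT]
    refine Finset.sum_congr ?_ fun _ _ => rfl
    ext l
    rw [Finite.mem_toFinset, Finset.mem_filter, hmem, hT.1.mem_circleSpectrum_iff_finrank,
      mem_sphere_zero_iff_norm]
    refine ⟨fun ⟨h1, h2⟩ => ⟨⟨?_, h2⟩, h1⟩, fun h => ⟨h.2, h.1.2⟩⟩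
    by_contra h
    refine genSpace_ne_bot h2 (genSpace_eq_bot (hres l ⟨by simpa using h1, fun h' => h ?_⟩))
    simpa using h'
  -- Reflection `l ↦ 1 / conj l` exchanges the exterior and the interior of the circle and preserves
  -- dimensions.
  have hinout : ∑ l ∈ s with 1 < ‖l‖, f l = ∑ l ∈ s with ‖l‖ < 1, f l := by
    refine Finset.sum_nbij' (fun l => conj l⁻¹) (fun l => conj l⁻¹) ?_ ?_ (by simp) (by simp) ?_
    · intro l hl
      obtain ⟨h1, h2⟩ := Finset.mem_filter.1 hl
      refine Finset.mem_filter.2 ⟨(hinv l h1).1, ?_⟩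
      rw [Complex.norm_conj, norm_inv]
      exact inv_lt_one_of_one_lt₀ h2
    · intro l hl
      obtain ⟨h1, h2⟩ := Finset.mem_filter.1 hl
      refine Finset.mem_filter.2 ⟨(hinv l h1).1, ?_⟩
      rw [Complex.norm_conj, norm_inv]
      exact (one_lt_inv₀ (norm_pos_iff.2 (hne l h1))).2 h2
    · intro l hl
      exact (hinv l (Finset.mem_filter.1 hl).1).2.symm
  have heven : Even (∑ l ∈ s with ‖l‖ < 1, f l) := by
    refine even_sum_of_conj (fun l hl => ?_) (fun l _ => hK.finrank_genSpace_conj hT l)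
      fun l _ hl => hK.even_finrank_genSpace hT hη hl
    obtain ⟨h1, h2⟩ := Finset.mem_filter.1 hl
    exact Finset.mem_filter.2 ⟨hconj l h1, by rwa [Complex.norm_conj]⟩
  have hsplit : ∑ l ∈ s, f l = (∑ l ∈ s with ‖l‖ = 1, f l) +
      ((∑ l ∈ s with 1 < ‖l‖, f l) + ∑ l ∈ s with ‖l‖ < 1, f l) := by
    simp only [Finset.sum_filter, ← Finset.sum_add_distrib]
    refine Finset.sum_congr rfl fun l _ => ?_
    rcases lt_trichotomy ‖l‖ 1 with h | h | h
    · simp [h, h.ne, h.not_gt]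
    · simp [h]
    · simp [h, h.ne', h.not_gt]
  rw [← hon, ← htotal, hinout] at hsplit
  obtain ⟨k, hk⟩ := heven
  rw [hk] at hsplit
  -- The parts inside and outside are each `k + k`, so the totals differ by `4 k`, and the
  -- natural-number halves by exactly `2 k`.
  have h1 : totalInertia J T₀ / 2 = totalInertia J T / 2 + 2 * k := by omega
  rw [sig₂, sig₂, h1, Nat.cast_add, Nat.cast_mul]
  have h2 : ((2 : ℕ) : ZMod 2) = 0 := rfl
  rw [h2, zero_mul, add_zero]

end IsRealKreinSpace

end Main

end RealKrein

open RealKrein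
theorem mainTheorem6 {K : Type*} [NormedAddCommGroup K] [InnerProductSpace ℂ K] [CompleteSpace K]
    [TopologicalSpace.SeparableSpace K]
    (C : K ≃ₗᵢ⋆[ℂ] K) (J S : K →L[ℂ] K) (η τ : ℤˣ) (hK : IsRealKreinSpace C J S η τ) :
    (∀ T ∈ gappedRealJUnitaries C J S,
      (circleSpectrum T).Finite ∧
        (Function.support fun z : ℂ => kreinSig J T z) ⊆ circleSpectrum T) ∧
    (η = 1 ∧ τ = 1 →
      IsLocallyConstant fun T : gappedRealJUnitaries C J S => sec J (T : K →L[ℂ] K)) ∧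
    (η = -1 ∧ τ = -1 →
      (∀ T ∈ gappedRealJUnitaries C J S,
        globalSig J T = 0 ∧
        FiniteDimensional ℂ (rieszSpaceCircle T) ∧
        totalInertia J T = Module.finrank ℂ (rieszSpaceCircle T) ∧
        Even (totalInertia J T)) ∧
      IsLocallyConstant fun T : gappedRealJUnitaries C J S => sig₂ J (T : K →L[ℂ] K)) ∧
    (η = -1 ∧ τ = 1 → ∀ T ∈ gappedRealJUnitaries C J S, Even (globalSig J T)) ∧
    (η = 1 ∧ τ = -1 → ∀ T ∈ gappedRealJUnitaries C J S, globalSig J T = 0) := by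
  refine ⟨fun T hT => ⟨hT.1.finite_circleSpectrum, fun z hz => ?_⟩,
    fun _ => hK.isLocallyConstant_sec,
    fun h => ⟨fun T hT => ⟨hK.globalSig_eq_zero hT h.2, hT.1.finiteDimensional_rieszSpaceCircle,
      ?_, hK.even_totalInertia hT h.1⟩, hK.isLocallyConstant_sig₂ h.1⟩,
    fun h T hT => hK.even_globalSig hT h.1, fun h T hT => hK.globalSig_eq_zero hT h.2⟩
  · by_contra h
    exact hz (kreinSig_eq_zero h)
  · rw [hT.1.totalInertia_eq hK.J_adjoint hK.J_sq, hT.1.finrank_rieszSpaceCircle]
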